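/- For a finite simple graph $G$ and $k\in\mathbb N$, a packing $k$-coloring of $G$ is a map $\varphi:V(G)\to\{1,\dots,k\}$ such that any two distinct vertices $u,v$ with $\varphi(u)=\varphi(v)$ are at distance at least $\varphi(u)+1$; the packing chromatic number $\chi_P(G)$ is the smallest $k$ for which $G$ has a packing $k$-coloring. A graph is chordal if every cycle of length at least $4$ has a chord. The packing chromatic number can be computed in polynomial time on chordal graphs of diameter $2$: there is a Turing machine with finite alphabets and a polynomial $p$ such that, for every chordal graph $G$ of diameter $2$ on a vertex set $\{0,\dots,n-1\}$, the machine, given the adjacency matrix of $G$ as a word of length $N=n(n+1)$ (the rows in order, each followed by an end-of-row mark), halts after at most $p(N)$ steps with output $\chi_P(G)$ in binary. Moreover, for every finite graph $G$ of diameter $2$, color $1$ is the only color that a packing coloring of $G$ can use more than once, and $\chi_P(G)+\alpha(G)=|V(G)|+1$, where $\alpha(G)$ is the largest size of an independent set of $G$. -/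

import Mathlib

namespace SimpleGraph

/-- A graph is chordal if every cycle of length at least four has a chord: an edge of the graph
that joins two vertices of the cycle and is not an edge of the cycle. -/
def IsChordal {V : Type*} (G : SimpleGraph V) : Prop :=
  ∀ (u : V) (p : G.Walk u u), p.IsCycle → 4 ≤ p.length →
    ∃ x ∈ p.support, ∃ y ∈ p.support, G.Adj x y ∧ s(x, y) ∉ p.edges

/-- A packing `k`-coloring: colors in `{1, …, k}`, and two different vertices of the same color `c`
are at distance at least `c + 1` (vertices in different components are at distance `⊤`). -/
def IsPackingColoring {V : Type*} (G : SimpleGraph V) (k : ℕ) (φ : V → ℕ) : Prop :=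
  (∀ v, 1 ≤ φ v ∧ φ v ≤ k) ∧
    ∀ u v, u ≠ v → φ u = φ v → (φ u : ℕ∞) + 1 ≤ G.edist u v

/-- The packing chromatic number: the least `k` such that there is a packing `k`-coloring. -/
noncomputable def packingChromaticNumber {V : Type*} (G : SimpleGraph V) : ℕ :=
  sInf {k | ∃ φ : V → ℕ, G.IsPackingColoring k φ}

/-- A finite graph has a packing coloring, so the infimum above is a minimum over a nonempty set. -/
theorem exists_isPackingColoring {V : Type*} [Fintype V] (G : SimpleGraph V) :
    ∃ (k : ℕ) (φ : V → ℕ), G.IsPackingColoring k φ := by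
  refine ⟨Fintype.card V, fun v => (Fintype.equivFin V v : ℕ) + 1,
    fun v => ⟨Nat.le_add_left _ _, (Fintype.equivFin V v).isLt⟩, fun u v huv h => ?_⟩
  exact absurd ((Fintype.equivFin V).injective (Fin.ext (Nat.succ_injective h))) huv

open Classical in
/-- The adjacency matrix of a graph on `{0, …, n - 1}` as a word: row after row, each row being its
`n` entries (`some true` for an edge, `some false` for a non-edge) followed by the end-of-row
mark `none`. -/
noncomputable def adjMatrixWord {n : ℕ} (G : SimpleGraph (Fin n)) : List (Option Bool) :=
  (List.finRange n).flatMap fun i =>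
    ((List.finRange n).map fun j => some (decide (G.Adj i j))) ++ [none]

end SimpleGraph

/-- `f` is computable in polynomial time: a multi-stack Turing machine with finite alphabets turns
the word `ea a` into the word `eb (f a)`, in a number of steps bounded by a polynomial in the length
of `ea a`, for every `a : α`. When `α` is a subtype, nothing is required of the machine on other
inputs. -/
def PolyTimeComputable {α β A B : Type} (ea : α → List A) (eb : β → List B) (f : α → β) : Prop :=
  ∃ M : Turing.TM2ComputableInPolyTime ea eb f, ∀ k, Finite (M.tm.Γ k)

/-- The finite chordal graphs of diameter `2`, with vertex set `{0, …, n - 1}`. -/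
def ChordalDiamTwo : Type :=
  {g : Σ n : ℕ, SimpleGraph (Fin n) // g.2.IsChordal ∧ g.2.ediam = 2}

/-! In diameter 2 all distances are at most 2, so a repeated color c satisfies c + 1 ≤ 2: only color
1 repeats, and its class is independent. An optimal packing coloring therefore gives color 1 to a
maximum independent set and a private color to every other vertex, whence χ_P = n + 1 - α
(`packingChromaticNumber_add_indepNum`). It remains to compute α.

In a chordal graph every nonempty vertex set S contains a vertex that is simplicial in S (Dirac,
`IsChordal.exists_isSimplicialIn`). Its closed neighborhood in S is a clique, which an independent
set meets at most once, so deleting it lowers the independence number by exactly 1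
(`IsSimplicialIn.indepNumIn_filter`). Greedy deletion thus computes α. The machine starts with n + 1
colors in unary, spends one per deletion and writes the remaining n + 1 - α in binary. It sweeps n
times over all vertices; a sweep over a nonempty alive set deletes at least one vertex
(`card_aliveSet_visitSteps`), so n sweeps exhaust the graph.

The machine is written in a small structured language whose semantics `Exec` carries a step bound.
`Exec.reachesWithin` compiles such programs to multi-stack Turing machines, and loop invariants
describe the stacks between rounds. -/

/-! ### Structured stack programs and their compilation to Turing machines -/

/-- Structured programs over a family of stacks, with stack alphabets `Γ`. -/
inductive StackProg {K : Type} (Γ : K → Type) : Type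
  /-- do nothing -/
  | skip : StackProg Γ
  /-- push a symbol -/
  | push (k : K) (a : Γ k) : StackProg Γ
  /-- sequential composition -/
  | seq (c d : StackProg Γ) : StackProg Γ
  /-- pop a stack and branch on the outcome -/
  | pop (k : K) (body : Option (Γ k) → StackProg Γ) : StackProg Γ
  /-- pop a stack until it is empty and run `body` on each symbol -/
  | loop (k : K) (body : Γ k → StackProg Γ) : StackProg Γ

namespace StackProg

open Turing

variable {K : Type} {Γ : K → Type}

/-- The program points of a program. -/
def Label : StackProg Γ → Type
  | skip => Unit
  | push _ _ => Unit
  | seq c d => c.Label ⊕ d.Label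
  | pop _ body => Option (Σ o, (body o).Label)
  | loop _ body => Option (Σ a, (body a).Label)

/-- The first program point. -/
def entry : (c : StackProg Γ) → c.Label
  | skip => ()
  | push _ _ => ()
  | seq c _ => Sum.inl c.entry
  | pop _ _ => none
  | loop _ _ => none

theorem finite_label [∀ k, Finite (Γ k)] : ∀ c : StackProg Γ, Finite c.Label
  | skip => inferInstanceAs (Finite Unit)
  | push _ _ => inferInstanceAs (Finite Unit)
  | seq c d =>
    have := finite_label c
    have := finite_label d
    inferInstanceAs (Finite (c.Label ⊕ d.Label))
  | pop _ body =>
    have := fun o => finite_label (body o)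
    inferInstanceAs (Finite (Option (Σ o, (body o).Label)))
  | loop _ body =>
    have := fun o => finite_label (body o)
    inferInstanceAs (Finite (Option (Σ o, (body o).Label)))

variable [DecidableEq K]

/-- The code of a program as part of a machine with labels `Λ`: its program points are embedded
by `emb`, and it ends by jumping to `exit`. The internal state stores the last symbol popped from
each stack. -/
def code {Λ : Type} : (c : StackProg Γ) → (emb : c.Label → Λ) → (exit : Λ) → c.Label →
    TM2.Stmt Γ Λ (∀ k, Option (Γ k))
  | skip, _, exit, _ => .goto fun _ => exit
  | push k a, _, exit, _ => .push k (fun _ => a) (.goto fun _ => exit)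
  | seq c d, emb, _, .inl l => code c (fun l => emb (.inl l)) (emb (.inr d.entry)) l
  | seq _ d, emb, exit, .inr l => code d (fun l => emb (.inr l)) exit l
  | pop k body, emb, _, none =>
    .pop k (fun s o => Function.update s k o) (.goto fun s => emb (some ⟨s k, (body (s k)).entry⟩))
  | pop _ body, emb, exit, some ⟨o, l⟩ => code (body o) (fun l => emb (some ⟨o, l⟩)) exit l
  | loop k body, emb, exit, none =>
    .pop k (fun s o => Function.update s k o)
      (.goto fun s => (s k).elim exit fun a => emb (some ⟨a, (body a).entry⟩))
  | loop _ body, emb, _, some ⟨a, l⟩ =>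
    code (body a) (fun l => emb (some ⟨a, l⟩)) (emb none) l

/-- `Exec c S S' t`: started on the stacks `S`, the program `c` ends with the stacks `S'` after at
most `t` steps. -/
inductive Exec : StackProg Γ → (∀ k, List (Γ k)) → (∀ k, List (Γ k)) → ℕ → Prop
  | skip (S) : Exec skip S S 1
  | push (k a S) : Exec (push k a) S (Function.update S k (a :: S k)) 1
  | seq {c d S S' S'' t t'} : Exec c S S' t → Exec d S' S'' t' → Exec (seq c d) S S'' (t + t')
  | pop {k body S S' t} :
    Exec (body (S k).head?) (Function.update S k (S k).tail) S' t → Exec (pop k body) S S' (t + 1)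
  | loop_nil {k body S} : S k = [] → Exec (loop k body) S S 1
  | loop_cons {k body S S' S'' a l t t'} : S k = a :: l →
    Exec (body a) (Function.update S k l) S' t → Exec (loop k body) S' S'' t' →
    Exec (loop k body) S S'' (t + 1 + t')
  | mono {c S S' t t'} : Exec c S S' t → t ≤ t' → Exec c S S' t'

/-- A machine goes from one configuration to another in at most `t` steps. -/
def ReachesWithin {Λ σ : Type} (M : Λ → TM2.Stmt Γ Λ σ) (a b : TM2.Cfg Γ Λ σ) (t : ℕ) : Prop :=
  ∃ n ≤ t, (flip bind (TM2.step M))^[n] (some a) = some b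

theorem ReachesWithin.trans {Λ σ : Type} {M : Λ → TM2.Stmt Γ Λ σ} {a b c : TM2.Cfg Γ Λ σ}
    {t t' : ℕ} (h : ReachesWithin M a b t) (h' : ReachesWithin M b c t') :
    ReachesWithin M a c (t + t') := by
  obtain ⟨n, hn, e⟩ := h
  obtain ⟨n', hn', e'⟩ := h'
  refine ⟨n' + n, by omega, ?_⟩
  rw [Function.iterate_add_apply, e, e']

theorem ReachesWithin.single {Λ σ : Type} {M : Λ → TM2.Stmt Γ Λ σ} {a b : TM2.Cfg Γ Λ σ}
    (h : TM2.step M a = some b) : ReachesWithin M a b 1 :=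
  ⟨1, le_rfl, h⟩

/-- Correctness of the compilation, by induction on the execution. The initial state `v` is
arbitrary and the final one existential: control depends on a stored symbol only immediately after
the pop that stored it. In a loop the body is compiled with the loop head as its exit. -/
theorem Exec.reachesWithin {c : StackProg Γ} {S S' : ∀ k, List (Γ k)} {t : ℕ}
    (h : Exec c S S' t) {Λ : Type} (M : Λ → TM2.Stmt Γ Λ (∀ k, Option (Γ k)))
    (emb : c.Label → Λ) (exit : Λ) (hM : ∀ l, M (emb l) = code c emb exit l)
    (v : ∀ k, Option (Γ k)) :
    ∃ v', ReachesWithin M ⟨some (emb c.entry), v, S⟩ ⟨some exit, v', S'⟩ t := by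
  induction h generalizing exit v with
  | skip S => exact ⟨v, .single (by simp [hM, code])⟩
  | push k a S => exact ⟨v, .single (by simp [hM, code])⟩
  | seq _ _ ih ih' =>
    obtain ⟨v', h⟩ := ih (fun l => emb (.inl l)) _ (fun l => hM (.inl l)) v
    obtain ⟨v'', h'⟩ := ih' (fun l => emb (.inr l)) exit (fun l => hM (.inr l)) v'
    exact ⟨v'', h.trans h'⟩
  | @pop k body S S' t _ ih =>
    obtain ⟨v', h⟩ := ih (fun l => emb (some ⟨_, l⟩)) exit (fun l => hM (some ⟨_, l⟩))
      (Function.update v k (S k).head?)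
    refine ⟨v', ?_⟩
    rw [add_comm]
    refine ReachesWithin.trans (.single ?_) h
    have h₀ : M (emb none) = _ := hM none
    simp only [code] at h₀
    simp [entry, h₀]
    rw [Function.update_self]
  | @loop_nil k body S hS =>
    refine ⟨Function.update v k none, .single ?_⟩
    have : Function.update S k (S k).tail = S := by simp [hS]
    have h₀ : M (emb none) = _ := hM none
    simp only [code] at h₀
    simp only [entry, TM2.step, h₀, TM2.stepAux, Function.update_self, this]
    simp [hS]
  | @loop_cons k body S S' S'' a l t t' hS _ _ ih ih' =>
    obtain ⟨v', h⟩ := ih (fun l => emb (some ⟨a, l⟩)) (emb none) (fun l => hM (some ⟨a, l⟩))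
      (Function.update v k (some a))
    obtain ⟨v'', h'⟩ := ih' emb exit hM v'
    refine ⟨v'', ?_⟩
    rw [add_comm t]
    refine (ReachesWithin.trans (.single ?_) h).trans h'
    have h₀ : M (emb none) = _ := hM none
    simp only [code] at h₀
    simp [entry, h₀, hS]
  | mono _ h ih =>
    obtain ⟨v', n, hn, e⟩ := ih emb exit hM v
    exact ⟨v', n, hn.trans h, e⟩

theorem initList_eq (tm : FinTM2) (s : List (tm.Γ tm.k₀)) :
    initList tm s = ⟨some tm.main, tm.initialState, Function.update (fun _ => []) tm.k₀ s⟩ := by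
  simp only [initList]
  congr 1
  funext k
  obtain rfl | hk := eq_or_ne k tm.k₀
  · simp
  · simp [hk]

theorem haltList_eq (tm : FinTM2) (s : List (tm.Γ tm.k₁)) :
    haltList tm s = ⟨none, tm.initialState, Function.update (fun _ => []) tm.k₁ s⟩ := by
  simp only [haltList]
  congr 1
  funext k
  obtain rfl | hk := eq_or_ne k tm.k₁
  · simp
  · simp [hk]

/-- A program that turns the stack `k₀` into the stack `k₁` in polynomial time and leaves the
other stacks empty gives a polynomial-time Turing machine. -/
theorem polyTimeComputable [Fintype K] [∀ k, Finite (Γ k)] {α β : Type} (c : StackProg Γ)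
    (k₀ k₁ : K) (ea : α → List (Γ k₀)) (eb : β → List (Γ k₁)) (f : α → β) (p : Polynomial ℕ)
    (h : ∀ a, Exec c (Function.update (fun _ => []) k₀ (ea a))
      (Function.update (fun _ => []) k₁ (eb (f a))) (p.eval (ea a).length)) :
    PolyTimeComputable ea eb f := by
  classical
  have := finite_label c
  let := Fintype.ofFinite c.Label
  let := fun k => Fintype.ofFinite (Γ k)
  -- The extra label `none` resets the internal state before halting, since `haltList` prescribes
  -- the initial state; this is the `+ 1` in the time bound.
  let M : Option c.Label → TM2.Stmt Γ (Option c.Label) (∀ k, Option (Γ k)) := fun l =>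
    l.elim (.load (fun _ _ => none) .halt) fun l => code c some none l
  refine ⟨{ tm :=
              { k₀ := k₀
                k₁ := k₁
                Γ := Γ
                Λ := Option c.Label
                main := some c.entry
                σ := ∀ k, Option (Γ k)
                initialState := fun _ => none
                m := M }
            inputAlphabet := Equiv.refl _
            outputAlphabet := Equiv.refl _
            time := p + 1
            outputsFun := fun a => Classical.choice ?_ }, fun k => ?_⟩
  · obtain ⟨v', hv⟩ := (h a).reachesWithin M some none (fun l => rfl) (fun _ => none)
    obtain ⟨n, hn, e⟩ := hv.trans
      (ReachesWithin.single (b := ⟨none, fun _ => none,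
        Function.update (fun _ => []) k₁ (eb (f a))⟩) rfl)
    refine ⟨⟨⟨n, ?_⟩, by simpa using hn⟩⟩
    simp only [initList_eq, haltList_eq, Option.map_some]
    rw [show ∀ l : List (Γ k₀), List.map (Equiv.refl (Γ k₀)).invFun l = l from List.map_id,
      show ∀ l : List (Γ k₁), List.map (Equiv.refl (Γ k₁)).invFun l = l from List.map_id]
    exact e
  · exact inferInstanceAs (Finite (Γ k))

end StackProg

/-! ### Chordal graphs and simplicial vertices -/

namespace SimpleGraph

variable {V : Type*} {G : SimpleGraph V}

/-- A shortest walk has no chords. -/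
theorem Walk.mem_edges_of_length_eq_dist {u v a b : V} (p : G.Walk u v)
    (hp : p.length = G.dist u v) (ha : a ∈ p.support) (hb : b ∈ p.support) (hab : G.Adj a b) :
    s(a, b) ∈ p.edges := by
  classical
  -- A subwalk of a shortest walk is shortest, so between adjacent vertices it is a single edge.
  have key : ∀ (a b : V) (r : G.Walk a b), G.Adj a b → r.IsSubwalk p → s(a, b) ∈ p.edges := by
    intro a b r hab hr
    apply hr.edges_subset
    have hl := length_eq_dist_of_subwalk hp hr
    rw [dist_eq_one_iff_adj.2 hab] at hl
    cases r with
    | nil => simp at hl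
    | cons _ q =>
      cases q with
      | nil => simp
      | cons _ _ => simp at hl
  have h := ha
  -- Split `p` at `b`: the vertex `a` lies on one of the two parts, which gives a subwalk between
  -- `a` and `b` in one of the two directions.
  rw [← p.take_spec hb, Walk.mem_support_append_iff] at h
  rcases h with h | h
  · exact key a b _ hab (((p.takeUntil b hb).isSubwalk_dropUntil h).trans
      (p.isSubwalk_takeUntil hb))
  · rw [Sym2.eq_swap]
    exact key b a _ hab.symm (((p.dropUntil b hb).isSubwalk_takeUntil h).trans
      (p.isSubwalk_dropUntil hb))

/-- The edges of `G` inside `T`. -/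
abbrev edgesWithin (G : SimpleGraph V) (T : Set V) : SimpleGraph V :=
  ((⊤ : G.Subgraph).induce T).spanningCoe

theorem edgesWithin_adj {T : Set V} {a b : V} :
    (G.edgesWithin T).Adj a b ↔ a ∈ T ∧ b ∈ T ∧ G.Adj a b := by
  simp [edgesWithin]

theorem edgesWithin_le (T : Set V) : G.edgesWithin T ≤ G := Subgraph.spanningCoe_le _

theorem edgesWithin_mono {T T' : Set V} (h : T ⊆ T') : G.edgesWithin T ≤ G.edgesWithin T' := by
  intro a b hab
  rw [edgesWithin_adj] at hab ⊢
  exact ⟨h hab.1, h hab.2.1, hab.2.2⟩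

theorem Walk.support_subset_of_edgesWithin {T : Set V} {x y : V} (p : (G.edgesWithin T).Walk x y)
    (hx : x ∈ T) : ∀ z ∈ p.support, z ∈ T := by
  induction p with
  | nil => simpa using hx
  | cons h p ih =>
    intro z hz
    rw [Walk.support_cons, List.mem_cons] at hz
    rcases hz with rfl | hz
    · exact hx
    · exact ih (edgesWithin_adj.1 h).2.1 z hz

/-- Otherwise a shortest path from `x` to `y` inside `T`, closed up through `u`, is a cycle of
length at least 4. It has no chord: a shortest path has none, and `u` sees only `x` and `y` in `T`.
-/
theorem IsChordal.adj_of_reachable (hG : G.IsChordal) {T : Set V} {u x y : V} (hux : G.Adj u x)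
    (huy : G.Adj u y) (hxy : x ≠ y) (hx : x ∈ T) (hu : u ∉ T)
    (hT : ∀ z ∈ T, G.Adj u z → z = x ∨ z = y) (h : (G.edgesWithin T).Reachable x y) :
    G.Adj x y := by
  by_contra hadj
  obtain ⟨p, hp, hlen⟩ := h.exists_path_of_dist
  have hsupp := p.support_subset_of_edgesWithin hx
  have hl : 2 ≤ p.length := by
    rw [hlen]
    exact h.one_lt_dist_of_ne_of_not_adj hxy fun h => hadj (edgesWithin_le T h)
  let q := p.mapLe (edgesWithin_le T)
  have hqs : q.support = p.support := p.support_mapLe_eq_support _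
  have hqe : q.edges = p.edges := p.edges_mapLe_eq_edges _
  have huq : u ∉ q.support := fun h => hu (hsupp u (hqs ▸ h))
  have hcyc : (Walk.cons hux (q.concat huy.symm)).IsCycle := by
    rw [Walk.cons_isCycle_iff]
    refine ⟨(hp.mapLe _).concat huq huy.symm, fun h => ?_⟩
    rw [Walk.edges_concat, List.concat_eq_append, List.mem_append, List.mem_singleton] at h
    rcases h with h | h
    · exact huq (q.fst_mem_support_of_mem_edges h)
    · simp only [Sym2.eq_iff] at h
      rcases h with h | h
      · exact huy.ne h.1
      · exact hxy h.2
  obtain ⟨a, ha, b, hb, hab, hne⟩ := hG u _ hcyc (by simp [q]; omega)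
  simp only [Walk.support_cons, Walk.support_concat, Walk.edges_cons, Walk.edges_concat, List.concat_eq_append,
    List.mem_cons, List.mem_append, List.not_mem_nil, or_false, hqs, hqe, not_or] at ha hb hne
  have key : ∀ z, z ∈ p.support → G.Adj u z → s(u, z) = s(u, x) ∨ s(u, z) = s(y, u) := by
    intro z hz huz
    rcases hT z (hsupp z hz) huz with rfl | rfl
    · exact .inl rfl
    · exact .inr Sym2.eq_swap
  have ha' : a = u ∨ a ∈ p.support := by tauto
  have hb' : b = u ∨ b ∈ p.support := by tauto
  rcases ha' with rfl | ha' <;> rcases hb' with rfl | hb'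
  · exact hab.ne rfl
  · have := key b hb' hab
    tauto
  · have := key a ha' hab.symm
    rw [Sym2.eq_swap (a := b) (b := a)] at this
    tauto
  · exact hne.2.1 (p.mem_edges_of_length_eq_dist hlen ha' hb'
      (edgesWithin_adj.2 ⟨hsupp a ha', hsupp b hb', hab⟩))

/-- `v` is simplicial in the subgraph induced by `S`: its neighbors in `S` form a clique. -/
def IsSimplicialIn (G : SimpleGraph V) (S : Finset V) (v : V) : Prop :=
  ∀ x ∈ S, ∀ y ∈ S, G.Adj v x → G.Adj v y → x ≠ y → G.Adj x y

/-- Dirac: a vertex that is not adjacent to all others misses a simplicial vertex. -/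
theorem IsChordal.exists_isSimplicialIn_not_adj (hG : G.IsChordal) (S : Finset V) {u w : V}
    (hu : u ∈ S) (hw : w ∈ S) (huw : u ≠ w) (hadj : ¬ G.Adj u w) :
    ∃ z ∈ S, u ≠ z ∧ ¬ G.Adj u z ∧ G.IsSimplicialIn S z := by
  classical
  induction hn : S.card using Nat.strong_induction_on generalizing S u w with
  | _ n ih =>
  -- the vertices of the component of `w` in the graph without the closed neighborhood of `u`
  let D : Set V := {z | z ∈ S ∧ u ≠ z ∧ ¬ G.Adj u z}
  let C : Finset V := S.filter fun z => z ∈ D ∧ (G.edgesWithin D).Reachable w z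
  let N : Finset V := S.filter fun z => G.Adj u z ∧ ∃ c ∈ C, G.Adj z c
  have hwC : w ∈ C := by simp [C, D, hw, huw, hadj]
  have hCD : ∀ c ∈ C, c ∈ D := fun c hc => (Finset.mem_filter.1 hc).2.1
  -- Neighbors in `S` of vertices of `C` stay in `C ∪ N`, so a vertex of `C` that is simplicial in
  -- `C ∪ N` is simplicial in `S`.
  have hnb : ∀ c ∈ C, ∀ z ∈ S, G.Adj c z → z ∈ C ∪ N := by
    intro c hc z hz hcz
    obtain ⟨hcS, hcD, hcr⟩ := Finset.mem_filter.1 hc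
    rw [Finset.mem_union]
    have hzu : u ≠ z := by
      rintro rfl
      exact hcD.2.2 hcz.symm
    by_cases huz : G.Adj u z
    · exact .inr (Finset.mem_filter.2 ⟨hz, huz, c, hc, hcz.symm⟩)
    · have hzD : z ∈ D := ⟨hz, hzu, huz⟩
      exact .inl (Finset.mem_filter.2 ⟨hz, hzD,
        hcr.trans (Adj.reachable (edgesWithin_adj.2 ⟨hcD, hzD, hcz⟩))⟩)
  -- The separator `N` is a clique: any two of its vertices are joined by a path through the
  -- component `C`, whose vertices are not adjacent to `u`.
  have hN : ∀ x ∈ N, ∀ y ∈ N, x ≠ y → G.Adj x y := by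
    intro x hx y hy hxy
    obtain ⟨hxS, hux, c, hc, hxc⟩ := Finset.mem_filter.1 hx
    obtain ⟨hyS, huy, d, hd, hyd⟩ := Finset.mem_filter.1 hy
    obtain ⟨-, hcD, hcr⟩ := Finset.mem_filter.1 hc
    obtain ⟨-, hdD, hdr⟩ := Finset.mem_filter.1 hd
    refine hG.adj_of_reachable (T := insert x (insert y D)) hux huy hxy (by simp) ?_ ?_ ?_
    · rintro (h | h | h)
      · exact hux.ne h
      · exact huy.ne h
      · exact h.2.1 rfl
    · rintro z (h | h | h) huz
      · exact .inl h
      · exact .inr h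
      · exact absurd huz h.2.2
    · have hsub : D ⊆ insert x (insert y D) := fun z hz => .inr (.inr hz)
      have h₁ : (G.edgesWithin (insert x (insert y D))).Adj x c :=
        edgesWithin_adj.2 ⟨by simp, hsub hcD, hxc⟩
      have h₂ : (G.edgesWithin (insert x (insert y D))).Adj y d :=
        edgesWithin_adj.2 ⟨by simp, hsub hdD, hyd⟩
      exact h₁.reachable.trans
        (((hcr.symm.trans hdr).mono (edgesWithin_mono hsub)).trans h₂.symm.reachable)
  have hlt : (C ∪ N).card < n := by
    rw [← hn]
    apply Finset.card_lt_card
    rw [Finset.ssubset_iff_of_subset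
      (Finset.union_subset (Finset.filter_subset _ _) (Finset.filter_subset _ _))]
    refine ⟨u, hu, fun h => ?_⟩
    rcases Finset.mem_union.1 h with h | h
    · exact (hCD u h).2.1 rfl
    · exact (Finset.mem_filter.1 h).2.1.ne rfl
  -- it suffices to find a vertex of the component that is simplicial in `C ∪ N`
  suffices h : ∃ z ∈ C, G.IsSimplicialIn (C ∪ N) z by
    obtain ⟨z, hz, hs⟩ := h
    refine ⟨z, (hCD z hz).1, (hCD z hz).2.1, (hCD z hz).2.2, fun x hx y hy hzx hzy => ?_⟩
    exact hs x (hnb z hz x hx hzx) y (hnb z hz y hy hzy) hzx hzy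
  -- Induction on `C ∪ N`, which misses `u`, yields a simplicial vertex not adjacent to `a`. It
  -- cannot lie in the clique `N` when `a ∈ N`.
  by_cases h₁ : ∃ a ∈ N, ∃ b ∈ C ∪ N, a ≠ b ∧ ¬ G.Adj a b
  · obtain ⟨a, ha, b, hb, hab, hadj'⟩ := h₁
    obtain ⟨z, hz, haz, hnaz, hs⟩ := ih _ hlt (C ∪ N) (Finset.mem_union_right _ ha) hb hab hadj' rfl
    refine ⟨z, ?_, hs⟩
    rcases Finset.mem_union.1 hz with h | h
    · exact h
    · exact absurd (hN a ha z h haz) hnaz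
  -- Now vertices of `N` are adjacent to all of `C ∪ N`, so a vertex not adjacent to `a` again lies
  -- in `C`. If this case fails too, `C ∪ N` is a clique and `w` will do.
  by_cases h₂ : ∃ a ∈ C, ∃ b ∈ C ∪ N, a ≠ b ∧ ¬ G.Adj a b
  · obtain ⟨a, ha, b, hb, hab, hadj'⟩ := h₂
    obtain ⟨z, hz, haz, hnaz, hs⟩ := ih _ hlt (C ∪ N) (Finset.mem_union_left _ ha) hb hab hadj' rfl
    refine ⟨z, ?_, hs⟩
    rcases Finset.mem_union.1 hz with h | h
    · exact h
    · push Not at h₁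
      exact absurd (h₁ z h a (Finset.mem_union_left _ ha) haz.symm).symm hnaz
  · push Not at h₁ h₂
    refine ⟨w, hwC, fun x hx y hy _ _ hxy => ?_⟩
    rcases Finset.mem_union.1 hx with h | h
    · exact h₂ x h y hy hxy
    · exact h₁ x h y hy hxy

theorem IsChordal.exists_isSimplicialIn (hG : G.IsChordal) {S : Finset V} (hS : S.Nonempty) :
    ∃ z ∈ S, G.IsSimplicialIn S z := by
  by_cases h : ∃ u ∈ S, ∃ w ∈ S, u ≠ w ∧ ¬ G.Adj u w
  · obtain ⟨u, hu, w, hw, huw, hadj⟩ := h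
    obtain ⟨z, hz, -, -, hs⟩ := hG.exists_isSimplicialIn_not_adj S hu hw huw hadj
    exact ⟨z, hz, hs⟩
  · push Not at h
    obtain ⟨z, hz⟩ := hS
    exact ⟨z, hz, fun x hx y hy _ _ hxy => h x hx y hy hxy⟩

/-! ### Independence numbers of vertex subsets -/

open Classical in
/-- The largest size of an independent subset of `S`. -/
noncomputable def indepNumIn (G : SimpleGraph V) (S : Finset V) : ℕ :=
  (S.powerset.filter fun I : Finset V => G.IsIndepSet (I : Set V)).sup Finset.card

theorem IsIndepSet.card_le_indepNumIn {S I : Finset V} (h : G.IsIndepSet (I : Set V))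
    (hI : I ⊆ S) : I.card ≤ G.indepNumIn S := by
  classical
  exact Finset.le_sup (f := Finset.card) (by simp [hI, h])

theorem exists_card_eq_indepNumIn (G : SimpleGraph V) (S : Finset V) :
    ∃ I ⊆ S, G.IsIndepSet (I : Set V) ∧ I.card = G.indepNumIn S := by
  classical
  obtain ⟨I, hI, h⟩ := Finset.exists_mem_eq_sup
    (S.powerset.filter fun I : Finset V => G.IsIndepSet (I : Set V)) ⟨∅, by simp⟩ Finset.card
  rw [Finset.mem_filter, Finset.mem_powerset] at hI
  exact ⟨I, hI.1, hI.2, h.symm⟩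

theorem indepNumIn_empty (G : SimpleGraph V) : G.indepNumIn ∅ = 0 := by
  obtain ⟨I, hI, -, h⟩ := G.exists_card_eq_indepNumIn ∅
  rw [← h, Finset.subset_empty.1 hI, Finset.card_empty]

theorem indepNumIn_univ [Fintype V] (G : SimpleGraph V) :
    G.indepNumIn Finset.univ = G.indepNum := by
  apply le_antisymm
  · obtain ⟨I, -, hI, h⟩ := G.exists_card_eq_indepNumIn Finset.univ
    exact h ▸ hI.card_le_indepNum
  · obtain ⟨I, hI⟩ := G.exists_isNIndepSet_indepNum
    exact hI.card_eq ▸ hI.isIndepSet.card_le_indepNumIn (Finset.subset_univ I)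

/-- Taking a simplicial vertex into an independent set is optimal. -/
theorem IsSimplicialIn.indepNumIn_filter [DecidableEq V] [DecidableRel G.Adj] {S : Finset V} {v : V}
    (h : G.IsSimplicialIn S v) (hv : v ∈ S) :
    G.indepNumIn (S.filter fun x => ¬ (x = v ∨ G.Adj v x)) + 1 = G.indepNumIn S := by
  apply le_antisymm
  · obtain ⟨I, hI, hind, hc⟩ := G.exists_card_eq_indepNumIn
      (S.filter fun x => ¬ (x = v ∨ G.Adj v x))
    have hI' : ∀ x ∈ I, x ∈ S ∧ x ≠ v ∧ ¬ G.Adj v x := fun x hx => by simpa using hI hx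
    rw [← hc, ← Finset.card_insert_of_notMem fun hx => (hI' v hx).2.1 rfl]
    refine IsIndepSet.card_le_indepNumIn ?_ ?_
    · rw [Finset.coe_insert]
      rw [isIndepSet_iff] at hind ⊢
      refine hind.insert fun b hb _ => ⟨(hI' b hb).2.2, fun h => (hI' b hb).2.2 h.symm⟩
    · exact Finset.insert_subset hv fun x hx => (hI' x hx).1
  · obtain ⟨I, hI, hind, hc⟩ := G.exists_card_eq_indepNumIn S
    -- Split a maximum independent set: the part outside the closed neighborhood of `v` is counted
    -- by the smaller set, and the part inside, in a clique, has at most one vertex.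
    rw [← hc, ← Finset.card_filter_add_card_filter_not (s := I) (fun x => ¬ (x = v ∨ G.Adj v x))]
    apply add_le_add
    · refine IsIndepSet.card_le_indepNumIn (hind.mono ?_) (Finset.filter_subset_filter _ hI)
      exact_mod_cast Finset.filter_subset _ _
    · rw [Finset.card_le_one]
      intro a ha b hb
      simp only [Finset.mem_filter, not_not] at ha hb
      by_contra hab
      apply hind ha.1 hb.1 hab
      rcases ha.2 with rfl | ha'
      · rcases hb.2 with rfl | hb'
        · exact absurd rfl hab
        · exact hb'
      · rcases hb.2 with rfl | hb'
        · exact ha'.symm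
        · exact h a (hI ha.1) b (hI hb.1) ha' hb' hab

/-! ### Packing colorings in diameter 2 -/

/-- In a graph of diameter `2`, only color `1` can repeat. -/
theorem IsPackingColoring.eq_one_of_ediam_eq_two (hd : G.ediam = 2) {k : ℕ} {φ : V → ℕ}
    (h : G.IsPackingColoring k φ) {u v : V} (huv : u ≠ v) (he : φ u = φ v) : φ u = 1 := by
  have h₁ := (h.2 u v huv he).trans edist_le_ediam
  rw [hd] at h₁
  have h₂ : φ u + 1 ≤ 2 := by exact_mod_cast h₁
  have := (h.1 u).1
  omega

/-- Upper bound: color a maximum independent set with 1 and the other vertices injectively from 2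
on. Lower bound: the class of color 1 is independent, and the coloring is injective on the remaining
vertices, with values from 2 on. -/
theorem packingChromaticNumber_add_indepNum [Fintype V] (hd : G.ediam = 2) :
    G.packingChromaticNumber + G.indepNum = Fintype.card V + 1 := by
  classical
  have hα : G.indepNum ≤ Fintype.card V := by
    obtain ⟨I, hI⟩ := G.exists_isNIndepSet_indepNum
    exact hI.card_eq ▸ Finset.card_le_univ I
  apply le_antisymm
  · suffices h : G.packingChromaticNumber ≤ Fintype.card V - G.indepNum + 1 by omega
    apply Nat.sInf_le
    obtain ⟨I, hI⟩ := G.exists_isNIndepSet_indepNum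
    have hc : Fintype.card {v // v ∉ I} = Fintype.card V - G.indepNum := by
      rw [Fintype.card_subtype_compl, Fintype.card_coe, hI.card_eq]
    let e := Fintype.equivFinOfCardEq hc
    refine ⟨fun v => if h : v ∈ I then 1 else e ⟨v, h⟩ + 2, fun v => ?_, fun u v huv he => ?_⟩
    · by_cases h : v ∈ I
      · simp [h]
      · have := (e ⟨v, h⟩).isLt
        simp only [h, dite_false]
        omega
    · by_cases hu : u ∈ I <;> by_cases hv : v ∈ I
      · have hadj := hI.isIndepSet hu hv huv
        simp only [hu, dite_true, Nat.cast_one]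
        rw [ENat.add_one_le_iff (by simp)]
        by_contra hle
        rcases edist_le_one_iff_adj_or_eq.1 (not_lt.1 hle) with h | h
        · exact hadj h
        · exact huv h
      · simp [hu, hv] at he
      · simp [hu, hv] at he
      · simp only [hu, hv, dite_false, Nat.add_right_cancel_iff] at he
        exact absurd (congrArg Subtype.val (e.injective (Fin.ext he))) huv
  · have hmem := Nat.sInf_mem (exists_isPackingColoring G)
    change ∃ φ : V → ℕ, G.IsPackingColoring G.packingChromaticNumber φ at hmem
    obtain ⟨φ, hφ⟩ := hmem
    let I := Finset.univ.filter fun v => φ v = 1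
    have hI : I.card ≤ G.indepNum := by
      refine IsIndepSet.card_le_indepNum ?_
      intro u hu v hv huv hadj
      have hu : φ u = 1 := by simpa [I] using hu
      have hv : φ v = 1 := by simpa [I] using hv
      have h := hφ.2 u v huv (hu.trans hv.symm)
      rw [edist_eq_one_iff_adj.2 hadj, hu] at h
      have : (1 : ℕ) + 1 ≤ 1 := by exact_mod_cast h
      omega
    have hJ : (Finset.univ.filter fun v => ¬ φ v = 1).card
        ≤ (Finset.Icc 2 G.packingChromaticNumber).card := by
      apply Finset.card_le_card_of_injOn φ
      · intro v hv
        have hv : ¬ φ v = 1 := by simpa using hv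
        have := hφ.1 v
        simp only [Finset.coe_Icc, Set.mem_Icc]
        omega
      · intro u hu v _ he
        have hu : ¬ φ u = 1 := by simpa using hu
        by_contra huv
        exact hu (hφ.eq_one_of_ediam_eq_two hd huv he)
    have hsum := Finset.card_filter_add_card_filter_not (s := Finset.univ) fun v => φ v = 1
    rw [Finset.card_univ] at hsum
    change I.card + _ = _ at hsum
    rw [Nat.card_Icc] at hJ
    -- The count of the colors from 2 on is a truncated subtraction, so χ_P = 0 has to be excluded;
    -- an empty graph has diameter 0.
    have hpos : 1 ≤ G.packingChromaticNumber := by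
      have : Nonempty V := by
        by_contra hV
        rw [not_nonempty_iff] at hV
        have : Subsingleton V := inferInstance
        have : G.ediam = 0 := by simpa using this
        rw [this] at hd
        exact absurd hd (by decide)
      obtain ⟨v⟩ := this
      exact (hφ.1 v).1.trans (hφ.1 v).2
    omega

end SimpleGraph

/-! ### The stacks of the machine and rules for its runs -/

namespace StackProg

/-- The stacks of the machine that computes independence numbers of chordal graphs: the input,
two copies of the matrix, the alive vertices, two copies of the mask of a closed neighborhood, and
the result; a primed stack holds the part of its partner that has already been scanned. The
remaining stacks are a flag, counters for sweeps, vertices and colors, and a scratch stack. -/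
inductive Stack
  | inp | mat | mat' | row | row' | alive | alive' | msk | msk' | dup | dup'
  | flag | sweep | vert | vert' | color | out | tmp
  deriving DecidableEq

instance : Fintype Stack where
  elems := {.inp, .mat, .mat', .row, .row', .alive, .alive', .msk, .msk', .dup, .dup',
    .flag, .sweep, .vert, .vert', .color, .out, .tmp}
  complete := by intro k; cases k <;> decide

/-- The alphabets of the stacks. -/
abbrev Sym : Stack → Type
  | .inp | .mat | .mat' | .row | .row' => Option Bool
  | .alive | .alive' | .msk | .msk' | .dup | .dup' | .out | .tmp => Bool
  | .flag | .sweep | .vert | .vert' | .color => Unit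

instance (k : Stack) : Finite (Sym k) := by
  cases k <;> (dsimp only [Sym]; infer_instance)

/-- The contents of all stacks. -/
structure Stacks where
  inp : List (Option Bool) := []
  mat : List (Option Bool) := []
  mat' : List (Option Bool) := []
  row : List (Option Bool) := []
  row' : List (Option Bool) := []
  alive : List Bool := []
  alive' : List Bool := []
  msk : List Bool := []
  msk' : List Bool := []
  dup : List Bool := []
  dup' : List Bool := []
  flag : List Unit := []
  sweep : List Unit := []
  vert : List Unit := []
  vert' : List Unit := []
  color : List Unit := []
  out : List Bool := []
  tmp : List Bool := []

/-- The contents of one stack. -/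
@[reducible] def Stacks.get (s : Stacks) : ∀ k, List (Sym k)
  | .inp => s.inp
  | .mat => s.mat
  | .mat' => s.mat'
  | .row => s.row
  | .row' => s.row'
  | .alive => s.alive
  | .alive' => s.alive'
  | .msk => s.msk
  | .msk' => s.msk'
  | .dup => s.dup
  | .dup' => s.dup'
  | .flag => s.flag
  | .sweep => s.sweep
  | .vert => s.vert
  | .vert' => s.vert'
  | .color => s.color
  | .out => s.out
  | .tmp => s.tmp

/-- Replace the contents of one stack. -/
@[reducible] def Stacks.set (s : Stacks) : ∀ k, List (Sym k) → Stacks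
  | .inp, l => { s with inp := l }
  | .mat, l => { s with mat := l }
  | .mat', l => { s with mat' := l }
  | .row, l => { s with row := l }
  | .row', l => { s with row' := l }
  | .alive, l => { s with alive := l }
  | .alive', l => { s with alive' := l }
  | .msk, l => { s with msk := l }
  | .msk', l => { s with msk' := l }
  | .dup, l => { s with dup := l }
  | .dup', l => { s with dup' := l }
  | .flag, l => { s with flag := l }
  | .sweep, l => { s with sweep := l }
  | .vert, l => { s with vert := l }
  | .vert', l => { s with vert' := l }
  | .color, l => { s with color := l }
  | .out, l => { s with out := l }
  | .tmp, l => { s with tmp := l }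

theorem Stacks.get_set (s : Stacks) (k : Stack) (l : List (Sym k)) :
    (s.set k l).get = Function.update s.get k l := by
  funext k'
  by_cases h : k' = k
  · subst h
    rw [Function.update_self]
    cases k' <;> rfl
  · rw [Function.update_of_ne h]
    cases k <;> cases k' <;> first | rfl | exact absurd rfl h

theorem Stacks.get_set_self (s : Stacks) (k : Stack) (l : List (Sym k)) :
    (s.set k l).get k = l := by
  rw [get_set, Function.update_self]

theorem Stacks.get_set_of_ne (s : Stacks) {k k' : Stack} (h : k' ≠ k) (l : List (Sym k)) :
    (s.set k l).get k' = s.get k' := by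
  rw [get_set, Function.update_of_ne h]

theorem Stacks.get_injective : Function.Injective Stacks.get := by
  rintro ⟨⟩ ⟨⟩ h
  simp only [mk.injEq]
  refine ⟨congrFun h .inp, congrFun h .mat, congrFun h .mat', congrFun h .row, congrFun h .row',
    congrFun h .alive, congrFun h .alive', congrFun h .msk, congrFun h .msk', congrFun h .dup,
    congrFun h .dup', congrFun h .flag, congrFun h .sweep, congrFun h .vert, congrFun h .vert',
    congrFun h .color, congrFun h .out, congrFun h .tmp⟩

/-- `Run c s t s'`: the program `c` goes from `s` to `s'` in at most `t` steps. -/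
def Run (c : StackProg Sym) (s : Stacks) (t : ℕ) (s' : Stacks) : Prop :=
  Exec c s.get s'.get t

namespace Run

variable {c d : StackProg Sym} {s s' s'' : Stacks} {t t' : ℕ} {k : Stack}

theorem of_eq (h : Run c s t s') (hs : s' = s'') (ht : t ≤ t') : Run c s t' s'' :=
  hs ▸ Exec.mono h ht

theorem congr {r r' : Stacks} (h : Run c s t s') (hs : s = r) (hs' : s' = r') (ht : t ≤ t') :
    Run c r t' r' :=
  hs ▸ hs' ▸ Exec.mono h ht

theorem mono (h : Run c s t s') (ht : t ≤ t') : Run c s t' s' :=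
  Exec.mono h ht

theorem skip : Run skip s 1 s :=
  Exec.skip _

theorem push (k : Stack) (a : Sym k) : Run (push k a) s 1 (s.set k (a :: s.get k)) := by
  rw [Run, Stacks.get_set]
  exact Exec.push _ _ _

theorem seq (h : Run c s t s') (h' : Run d s' t' s'') : Run (seq c d) s (t + t') s'' :=
  Exec.seq h h'

theorem pop {body : Option (Sym k) → StackProg Sym}
    (h : Run (body (s.get k).head?) (s.set k (s.get k).tail) t s') :
    Run (pop k body) s (t + 1) s' := by
  rw [Run, Stacks.get_set] at h
  exact Exec.pop h

theorem loop_nil {body : Sym k → StackProg Sym} (h : s.get k = []) : Run (loop k body) s 1 s :=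
  Exec.loop_nil h

theorem loop_cons {body : Sym k → StackProg Sym} {a : Sym k} {l : List (Sym k)}
    (h : s.get k = a :: l) (hb : Run (body a) (s.set k l) t s')
    (hl : Run (loop k body) s' t' s'') : Run (loop k body) s (t + 1 + t') s'' := by
  rw [Run, Stacks.get_set] at hb
  exact Exec.loop_cons h hb hl

/-- A loop rule with the invariant `F i` after `i` rounds. -/
theorem loop_of_invariant {body : Sym k → StackProg Sym} (F : ℕ → Stacks) (n : ℕ)
    (h : ∀ i < n, ∃ a l, (F i).get k = a :: l ∧ Run (body a) ((F i).set k l) t (F (i + 1)))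
    (hn : (F n).get k = []) : Run (loop k body) (F 0) (n * (t + 1) + 1) (F n) := by
  -- Induct on the number `j` of rounds still to run, because `loop_cons` peels off the first round.
  suffices H : ∀ j ≤ n, Run (loop k body) (F (n - j)) (j * (t + 1) + 1) (F n) by
    simpa using H n le_rfl
  intro j
  induction j with
  | zero => intro _; simpa using loop_nil hn
  | succ j ih =>
    intro hj
    obtain ⟨a, l, hg, hr⟩ := h (n - (j + 1)) (by omega)
    rw [show n - (j + 1) + 1 = n - j by omega] at hr
    exact (loop_cons hg hr (ih (by omega))).mono (by rw [Nat.succ_mul]; omega)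

end Run

/-! ### Elementary programs and words -/

/-- Move a stack onto another one, symbol by symbol. -/
def move (k k' : Stack) (g : Sym k → Sym k') : StackProg Sym :=
  loop k fun a => push k' (g a)

theorem run_move {k k' : Stack} (hk : k' ≠ k) (g : Sym k → Sym k') (s : Stacks) :
    Run (move k k' g) s (2 * (s.get k).length + 1)
      ((s.set k []).set k' (((s.get k).map g).reverse ++ s.get k')) := by
  generalize hl : s.get k = l
  induction l generalizing s with
  | nil =>
    refine (Run.loop_nil hl).of_eq (Stacks.get_injective ?_) (by simp)
    have h : Function.update s.get k [] = s.get := by rw [← hl]; simp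
    rw [Stacks.get_set, Stacks.get_set, h]
    simp
  | cons a l ih =>
    have h₁ : ((s.set k l).set k' (g a :: (s.set k l).get k')).get k = l := by
      rw [Stacks.get_set_of_ne _ hk.symm, Stacks.get_set_self]
    refine (Run.loop_cons hl (Run.push k' (g a)) (ih _ h₁)).of_eq (Stacks.get_injective ?_)
      (by simp; omega)
    simp only [Stacks.get_set]
    funext j
    by_cases hj : j = k'
    · subst hj
      simp [Stacks.get_set_self, Stacks.get_set_of_ne _ hk]
    · by_cases hj' : j = k
      · subst hj'
        simp [Function.update_of_ne hj]
      · simp [Function.update_of_ne hj, Function.update_of_ne hj']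

/-- Empty a stack. -/
def clear (k : Stack) : StackProg Sym :=
  loop k fun _ => skip

theorem run_clear (k : Stack) (s : Stacks) :
    Run (clear k) s (2 * (s.get k).length + 1) (s.set k []) := by
  generalize hl : s.get k = l
  induction l generalizing s with
  | nil =>
    refine (Run.loop_nil hl).of_eq (Stacks.get_injective ?_) (by simp)
    rw [Stacks.get_set, ← hl]
    simp
  | cons a l ih =>
    refine (Run.loop_cons hl Run.skip (ih (s.set k l) (Stacks.get_set_self _ _ _))).of_eq
      (Stacks.get_injective ?_) (by simp; omega)
    simp only [Stacks.get_set]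
    simp

/-- The contents of a stack that stores a truth value. -/
def bit (b : Bool) : List Unit := if b then [()] else []

/-- Raise the flag. -/
def raise : StackProg Sym := seq (pop .flag fun _ => skip) (push .flag ())

/-- Popping first keeps at most one symbol on the flag stack, so that a single pop lowers the flag
however often it was raised. -/
theorem run_raise {s : Stacks} {b : Bool} (h : s.flag = bit b) :
    Run raise s 3 { s with flag := bit true } := by
  refine (Run.seq (Run.pop Run.skip) (Run.push _ _)).of_eq ?_ (by omega)
  cases b <;> simp [h, bit]

/-- The word `f i, …, f (n - 1)`. -/
def segment {α : Type} (f : ℕ → α) (i n : ℕ) : List α := (List.range' i (n - i)).map f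

/-- The word `f (n - 1), …, f 0`. -/
def reversed {α : Type} (f : ℕ → α) : ℕ → List α
  | 0 => []
  | n + 1 => f n :: reversed f n

/-- Whether `f` holds somewhere below `n`. -/
def anyBelow (f : ℕ → Bool) : ℕ → Bool
  | 0 => false
  | n + 1 => anyBelow f n || f n

section

variable {α : Type} (f : ℕ → α)

theorem segment_of_lt {i n : ℕ} (h : i < n) : segment f i n = f i :: segment f (i + 1) n := by
  rw [segment, segment, show n - i = (n - (i + 1)) + 1 by omega, List.range'_succ, List.map_cons]

theorem segment_self (n : ℕ) : segment f n n = [] := by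
  simp [segment]

theorem length_segment (i n : ℕ) : (segment f i n).length = n - i := by
  simp [segment]

theorem segment_const (a : α) (n : ℕ) : segment (fun _ => a) 0 n = List.replicate n a := by
  simp [segment, List.map_const']

theorem length_reversed (n : ℕ) : (reversed f n).length = n := by
  induction n with
  | zero => rfl
  | succ n ih => simp [reversed, ih]

theorem reverse_reversed (n : ℕ) : (reversed f n).reverse = segment f 0 n := by
  induction n with
  | zero => rfl
  | succ n ih =>
    rw [reversed, List.reverse_cons, ih, segment, segment]
    simp [List.range'_concat]

end

theorem anyBelow_eq_true {f : ℕ → Bool} {n : ℕ} : anyBelow f n = true ↔ ∃ i < n, f i = true := by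
  induction n with
  | zero => simp [anyBelow]
  | succ n ih =>
    rw [anyBelow, Bool.or_eq_true, ih]
    constructor
    · rintro (⟨i, hi, h⟩ | h)
      · exact ⟨i, by omega, h⟩
      · exact ⟨n, by omega, h⟩
    · rintro ⟨i, hi, h⟩
      rcases Nat.lt_succ_iff_lt_or_eq.1 hi with hi | rfl
      · exact .inl ⟨i, hi, h⟩
      · exact .inr h

attribute [simp] Stacks.get Stacks.set

theorem replicate_sub_of_lt {i n : ℕ} (h : i < n) :
    List.replicate (n - i) () = () :: List.replicate (n - (i + 1)) () := by
  rw [show n - i = (n - (i + 1)) + 1 by omega, List.replicate_succ]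

end StackProg

/-! ### Programs that process one symbol -/

namespace StackProg

/-- Raise the flag if `p` holds. -/
def raiseIf (p : Bool) : StackProg Sym := if p then raise else skip

theorem run_raiseIf {s : Stacks} {b : Bool} (p : Bool) (h : s.flag = bit b) :
    Run (raiseIf p) s 3 { s with flag := bit (b || p) } := by
  cases p
  · exact Run.skip.of_eq (by simp [← h]) (by omega)
  · exact (run_raise h).of_eq (by simp) le_rfl

/-- Process an entry of the current row, in the column of a vertex with alive bit `a`. -/
def maskEntry (a : Bool) : StackProg Sym :=
  pop .row fun o => o.elim skip fun c =>
    -- The mark `none` stands on the diagonal. The default `true` puts the visited vertex into its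
    -- own closed neighborhood, and a dead bit `a` at the mark means that the visited vertex itself
    -- is dead.
    seq (push .row' c) (seq (push .msk' (a && c.getD true)) (seq (push .dup' (a && c.getD true))
      (seq (raiseIf (c.isNone && !a)) (push .alive' a))))

theorem run_maskEntry {s : Stacks} {a b : Bool} {c : Option Bool} {l : List (Option Bool)}
    (hr : s.row = c :: l) (hf : s.flag = bit b) :
    Run (maskEntry a) s 8
      { s with
        row := l
        row' := c :: s.row'
        msk' := (a && c.getD true) :: s.msk'
        dup' := (a && c.getD true) :: s.dup'
        flag := bit (b || (c.isNone && !a))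
        alive' := a :: s.alive' } := by
  obtain ⟨⟩ := s
  simp only at hr hf
  subst hr hf
  exact (Run.pop (Run.seq (Run.push _ _) (Run.seq (Run.push _ _) (Run.seq (Run.push _ _)
    (Run.seq (run_raiseIf _ rfl) (Run.push _ _)))))).of_eq rfl (by omega)

/-- Check an entry of the matrix, in a row with mask bit `a` and a column with mask bit `b`. -/
def checkEntry (a b : Bool) : StackProg Sym :=
  pop .mat fun o => o.elim skip fun c =>
    seq (push .mat' c) (seq (raiseIf (a && b && !c.getD true)) (push .dup' b))

theorem run_checkEntry {s : Stacks} {a b p : Bool} {c : Option Bool} {l : List (Option Bool)}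
    (hr : s.mat = c :: l) (hf : s.flag = bit p) :
    Run (checkEntry a b) s 6
      { s with
        mat := l
        mat' := c :: s.mat'
        flag := bit (p || (a && b && !c.getD true))
        dup' := b :: s.dup' } := by
  obtain ⟨⟩ := s
  simp only at hr hf
  subst hr hf
  exact (Run.pop (Run.seq (Run.push _ _)
    (Run.seq (run_raiseIf _ rfl) (Run.push _ _)))).of_eq rfl (by omega)

/-- Remove the vertices of the mask, for one vertex with alive bit `a`. -/
def removeEntry (a : Bool) : StackProg Sym :=
  pop .msk fun o => o.elim skip fun c => push .alive' (a && !c)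

theorem run_removeEntry {s : Stacks} {a c : Bool} {l : List Bool} (hm : s.msk = c :: l) :
    Run (removeEntry a) s 2 { s with msk := l, alive' := (a && !c) :: s.alive' } := by
  obtain ⟨⟩ := s
  simp only at hm
  subst hm
  exact (Run.pop (Run.push _ _)).of_eq rfl (by omega)

/-- Copy an entry of the input to both matrices, counting with the flag stack. -/
def copyEntry : StackProg Sym :=
  pop .inp fun o => o.elim skip fun c => seq (push .mat' c) (seq (push .row' c) (push .flag ()))

theorem run_copyEntry {s : Stacks} {c : Option Bool} {l : List (Option Bool)}
    (h : s.inp = c :: l) :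
    Run copyEntry s 4
      { s with inp := l, mat' := c :: s.mat', row' := c :: s.row', flag := () :: s.flag } := by
  obtain ⟨⟩ := s
  simp only at h
  subst h
  exact (Run.pop (Run.seq (Run.push _ _) (Run.seq (Run.push _ _) (Run.push _ _)))).of_eq rfl
    (by omega)

/-- Register a symbol of the input, and count the vertices by the end-of-row marks. -/
def countEntry (c : Option Bool) : StackProg Sym :=
  seq (push .mat c) (if c = none then
    seq (push .vert ()) (seq (push .sweep ()) (seq (push .color ()) (push .alive true))) else skip)

/-- This is how the machine learns `n`: each end-of-row mark adds one to every unary counter and one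
alive vertex. -/
theorem run_loop_countEntry (w : List (Option Bool)) (s : Stacks) (h : s.inp = w) :
    Run (loop .inp countEntry) s (6 * w.length + 1)
      { s with
        inp := []
        mat := w.reverse ++ s.mat
        vert := List.replicate (w.count none) () ++ s.vert
        sweep := List.replicate (w.count none) () ++ s.sweep
        color := List.replicate (w.count none) () ++ s.color
        alive := List.replicate (w.count none) true ++ s.alive } := by
  induction w generalizing s with
  | nil =>
    obtain ⟨⟩ := s
    simp only at h
    subst h
    exact (Run.loop_nil (k := .inp) rfl).of_eq (by simp) (by simp)
  | cons c w ih =>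
    obtain ⟨⟩ := s
    simp only at h
    subst h
    rcases c with _ | c
    · refine (Run.loop_cons rfl (Run.seq (Run.push _ _) (Run.seq (Run.push _ _)
        (Run.seq (Run.push _ _) (Run.seq (Run.push _ _) (Run.push _ _))))) (ih _ rfl)).of_eq ?_ ?_
      · simp [List.replicate_succ']
      · simp; omega
    · refine (Run.loop_cons rfl (Run.seq (Run.push _ _) Run.skip) (ih _ rfl)).of_eq ?_ ?_
      · simp
      · simp; omega

/-! ### Binary counting -/

/-- The bits of the sum of a binary number and a carry, up to the length of the number. -/
def sumBits : Bool → List Bool → List Bool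
  | _, [] => []
  | c, b :: l => (b ^^ c) :: sumBits (b && c) l

/-- The carry that is left by the sum of a binary number and a carry. -/
def sumCarry : Bool → List Bool → Bool
  | c, [] => c
  | c, b :: l => sumCarry (b && c) l

/-- The successor of a binary number. -/
def binarySucc (l : List Bool) : List Bool :=
  sumBits true l ++ if sumCarry true l then [true] else []

theorem length_sumBits (c : Bool) (l : List Bool) : (sumBits c l).length = l.length := by
  induction l generalizing c with
  | nil => rfl
  | cons b l ih => simp [sumBits, ih]

/-- Add the carry in the flag to a bit. -/
def addCarry (b : Bool) : StackProg Sym :=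
  pop .flag fun o => seq (push .tmp (b ^^ o.isSome)) (if b && o.isSome then push .flag () else skip)

theorem run_loop_addCarry (l : List Bool) (c : Bool) (s : Stacks) (h : s.out = l)
    (hc : s.flag = bit c) :
    Run (loop .out addCarry) s (4 * l.length + 1)
      { s with
        out := []
        flag := bit (sumCarry c l)
        tmp := (sumBits c l).reverse ++ s.tmp } := by
  induction l generalizing s c with
  | nil =>
    obtain ⟨⟩ := s
    simp only at h hc
    subst h hc
    exact (Run.loop_nil (k := .out) rfl).of_eq (by simp [sumCarry, sumBits]) (by simp)
  | cons b l ih =>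
    obtain ⟨⟩ := s
    simp only at h hc
    subst h hc
    cases b <;> cases c
    · refine (Run.loop_cons rfl (Run.pop (Run.seq (Run.push _ _) Run.skip))
        (ih false _ rfl rfl)).of_eq ?_ ?_
      · simp [sumCarry, sumBits, bit]
      · simp; omega
    · refine (Run.loop_cons rfl (Run.pop (Run.seq (Run.push _ _) Run.skip))
        (ih false _ rfl rfl)).of_eq ?_ ?_
      · simp [sumCarry, sumBits, bit]
      · simp; omega
    · refine (Run.loop_cons rfl (Run.pop (Run.seq (Run.push _ _) Run.skip))
        (ih false _ rfl rfl)).of_eq ?_ ?_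
      · simp [sumCarry, sumBits, bit]
      · simp; omega
    · refine (Run.loop_cons rfl (Run.pop (Run.seq (Run.push _ _) (Run.push _ _)))
        (ih true _ rfl rfl)).of_eq ?_ ?_
      · simp [sumCarry, sumBits, bit]
      · simp; omega

/-- Increment the binary number on the output stack. -/
def increment : StackProg Sym :=
  seq raise (seq (loop .out addCarry)
    (seq (pop .flag fun o => if o.isSome then push .tmp true else skip) (move .tmp .out id)))

theorem run_increment {s : Stacks} (hf : s.flag = []) (ht : s.tmp = []) :
    Run increment s (6 * s.out.length + 9) { s with out := binarySucc s.out } := by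
  have h : ∀ (c : Bool) (s : Stacks), s.flag = bit c →
      Run (pop .flag fun o => if o.isSome then push .tmp true else skip) s 2
        { s with flag := [], tmp := (if c then [true] else []) ++ s.tmp } := by
    intro c s hc
    obtain ⟨⟩ := s
    simp only at hc
    subst hc
    cases c
    · exact (Run.pop Run.skip).of_eq rfl (by omega)
    · exact (Run.pop (Run.push _ _)).of_eq rfl (by omega)
  refine ((run_raise (b := false) hf).seq
    ((run_loop_addCarry s.out true { s with flag := bit true } rfl rfl).seq
      ((h (sumCarry true s.out) _ rfl).seq
        (run_move (k := .tmp) (k' := .out) (by decide) id _)))).of_eq ?_ ?_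
  · obtain ⟨⟩ := s
    simp only at hf ht
    subst hf ht
    simp [binarySucc]
    split <;> simp
  · rw [ht]
    simp [length_sumBits]
    split <;> simp <;> omega

theorem sumBits_false (l : List Bool) : sumBits false l = l := by
  induction l with
  | nil => rfl
  | cons b l ih => simp [sumBits, ih]

theorem sumCarry_false (l : List Bool) : sumCarry false l = false := by
  induction l with
  | nil => rfl
  | cons b l ih => simp [sumCarry, ih]

open Computability in
-- `encodePosNum` lists the least significant bit first, so the carry runs from the head of the
-- list.
theorem encodePosNum_succ (p : PosNum) :
    encodePosNum p.succ = binarySucc (encodePosNum p) := by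
  induction p with
  | one => rfl
  | bit1 p ih =>
    simp only [PosNum.succ, encodePosNum, ih, binarySucc, sumBits, sumCarry]
    simp
  | bit0 p ih =>
    simp [PosNum.succ, encodePosNum, binarySucc, sumBits, sumCarry, sumBits_false, sumCarry_false]

open Computability in
theorem encodeNat_succ (n : ℕ) : encodeNat (n + 1) = binarySucc (encodeNat n) := by
  rw [encodeNat, encodeNat, Nat.cast_succ, Num.add_one]
  cases (n : Num) with
  | zero => rfl
  | pos p => exact encodePosNum_succ p

open Computability in
-- A crude bound, but enough for a polynomial running time.
theorem length_encodeNat_le (n : ℕ) : (encodeNat n).length ≤ n := by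
  induction n with
  | zero => simp [encodeNat, encodeNum]
  | succ n ih =>
    rw [encodeNat_succ, binarySucc, List.length_append, length_sumBits]
    split <;> simp <;> omega

open Computability in
/-- Counting the color stack in binary. -/
theorem run_loop_increment {s : Stacks} {q : ℕ} (hq : s.color = List.replicate q ())
    (hf : s.flag = []) (ht : s.tmp = []) (ho : s.out = []) :
    Run (loop .color fun _ => StackProg.increment) s (q * (6 * q + 9 + 1) + 1)
      { s with color := [], out := Computability.encodeNat q } := by
  refine (Run.loop_of_invariant (k := .color) (t := 6 * q + 9)
    (fun i => { s with
      color := List.replicate (q - i) (), out := Computability.encodeNat i }) q ?_ ?_).congr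
      ?_ ?_ le_rfl
  · intro i hi
    refine ⟨(), _, replicate_sub_of_lt hi, (run_increment (s := { s with
      color := List.replicate (q - (i + 1)) (), out := Computability.encodeNat i }) hf ht).of_eq
      ?_ ?_⟩
    · simp [encodeNat_succ]
    · have := length_encodeNat_le i
      simp only
      omega
  · simp
  · obtain ⟨⟩ := s
    simp only at hq ho
    subst hq ho
    rfl
  · simp

end StackProg

namespace StackProg

/-! ### Visiting a vertex: test for simpliciality and deletion -/

section Visit

/-- Compute the mask of the next row. -/
def scanRow : StackProg Sym :=
  seq (loop .alive maskEntry)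
    (seq (move .alive' .alive id) (seq (move .msk' .msk id) (move .dup' .dup id)))

/-- Raise the flag unless the mask is a clique. -/
def scanMatrix : StackProg Sym :=
  seq (loop .msk fun a =>
      seq (loop .dup (checkEntry a)) (seq (move .dup' .dup id) (push .msk' a)))
    (seq (move .msk' .msk id) (move .mat' .mat id))

/-- Unless the flag is raised, spend a color and remove the mask. -/
def applyMask : StackProg Sym :=
  pop .flag fun o => if o.isSome then clear .msk else
    seq (pop .color fun _ => skip) (seq (loop .alive removeEntry) (move .alive' .alive id))

/-- Process the next vertex. -/
def visit : StackProg Sym :=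
  seq scanRow (seq scanMatrix (seq applyMask (seq (clear .dup) (push .vert' ()))))

variable (n : ℕ) (e : ℕ → Option Bool) (L : ℕ → Bool) (v : ℕ)

/-- The alive closed neighbors of `v`, in a graph with flat matrix `e`. -/
def mask (j : ℕ) : Bool := L j && (e (v * n + j)).getD true

/-- Whether `v` is dead, in a graph with flat matrix `e`. -/
def isDead : Bool := anyBelow (fun j => (e (v * n + j)).isNone && !L j) n

/-- Whether there is a non-edge in the mask. -/
def hasNonEdge (m : ℕ → Bool) : Bool :=
  anyBelow (fun x => anyBelow (fun y => m x && m y && !(e (x * n + y)).getD true) n) n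

/-- Whether `v` is rejected as the next vertex of an independent set. -/
def isBad : Bool := isDead n e L v || hasNonEdge n e (mask n e L v)

/-- The effect of a visit on the alive vertices and the number of colors. -/
def visitStep (p : (ℕ → Bool) × ℕ) (v : ℕ) : (ℕ → Bool) × ℕ :=
  if isBad n e p.1 v then p else (fun j => p.1 j && !mask n e p.1 v j, p.2 - 1)

variable {n e L v}

theorem mul_add_lt {x j : ℕ} (hx : x < n) (hj : j < n) : x * n + j < n * n := by
  calc x * n + j < x * n + n := by omega
    _ = (x + 1) * n := by ring
    _ ≤ n * n := Nat.mul_le_mul_right n hx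

variable (sw ve ve' co : List Unit)

/-- The stack `row` is consumed by one row per visit, so row `v` is on top without any indexing.
Stacks that are not listed are empty, before and after. -/
theorem run_scanRow (hv : v < n) :
    Run scanRow
      { mat := segment e 0 (n * n), row := segment e (v * n) (n * n), row' := reversed e (v * n)
        alive := segment L 0 n, sweep := sw, vert := ve, vert' := ve', color := co }
      (15 * n + 4)
      { mat := segment e 0 (n * n), row := segment e ((v + 1) * n) (n * n)
        row' := reversed e ((v + 1) * n), alive := segment L 0 n
        msk := segment (mask n e L v) 0 n, dup := segment (mask n e L v) 0 n
        flag := bit (isDead n e L v)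
        sweep := sw, vert := ve, vert' := ve', color := co } := by
  have h : Run (loop .alive maskEntry) _ (n * (8 + 1) + 1) _ := Run.loop_of_invariant (fun j =>
    { mat := segment e 0 (n * n), row := segment e (v * n + j) (n * n)
      row' := reversed e (v * n + j), alive := segment L j n, alive' := reversed L j
      msk' := reversed (mask n e L v) j, dup' := reversed (mask n e L v) j
      flag := bit (anyBelow (fun j => (e (v * n + j)).isNone && !L j) j)
      sweep := sw, vert := ve, vert' := ve', color := co }) n
    (fun j hj => ⟨L j, _, segment_of_lt L hj,
      run_maskEntry (segment_of_lt e (mul_add_lt hv hj)) rfl⟩) (segment_self L n)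
  refine (h.seq ((run_move (k := .alive') (k' := .alive) (by decide) id _).seq
    ((run_move (k := .msk') (k' := .msk) (by decide) id _).seq
    (run_move (k := .dup') (k' := .dup) (by decide) id _)))).congr ?_ ?_ ?_
  · simp [reversed, anyBelow, bit]
  · simp [reverse_reversed, segment_self, isDead, Nat.succ_mul]
  · simp [length_reversed]
    omega

/-- Two copies of the mask are needed: `msk` is read once along the rows, `dup` is read and restored
for every row. Diagonal marks default to `true` and never count as non-edges. The outer invariant
keeps in the flag the non-edges of the rows already read. -/
theorem run_scanMatrix (r r' : List (Option Bool)) (m : ℕ → Bool) (b : Bool) :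
    Run scanMatrix
      { mat := segment e 0 (n * n), row := r, row' := r', alive := segment L 0 n
        msk := segment m 0 n, dup := segment m 0 n, flag := bit b
        sweep := sw, vert := ve, vert' := ve', color := co }
      (n * (9 * n + 3 + 1) + 2 * (n * n) + 2 * n + 3)
      { mat := segment e 0 (n * n), row := r, row' := r', alive := segment L 0 n
        msk := segment m 0 n, dup := segment m 0 n, flag := bit (b || hasNonEdge n e m)
        sweep := sw, vert := ve, vert' := ve', color := co } := by
  have h : Run (loop .msk fun a =>
      seq (loop .dup (checkEntry a)) (seq (move .dup' .dup id) (push .msk' a))) _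
      (n * (9 * n + 3 + 1) + 1) _ := Run.loop_of_invariant (fun x =>
    { mat := segment e (x * n) (n * n), mat' := reversed e (x * n), row := r, row' := r'
      alive := segment L 0 n, msk := segment m x n, msk' := reversed m x, dup := segment m 0 n
      flag := bit (b || anyBelow (fun x => anyBelow
        (fun y => m x && m y && !(e (x * n + y)).getD true) n) x)
      sweep := sw, vert := ve, vert' := ve', color := co }) n
    (fun x hx => ⟨m x, _, segment_of_lt m hx, ?_⟩) (segment_self m n)
  · refine (h.seq ((run_move (k := .msk') (k' := .msk) (by decide) id _).seq
      (run_move (k := .mat') (k' := .mat) (by decide) id _))).congr ?_ ?_ ?_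
    · simp [reversed, anyBelow]
    · simp [reverse_reversed, segment_self, hasNonEdge]
    · simp [length_reversed]
      omega
  · have h : Run (loop .dup (checkEntry (m x))) _ (n * (6 + 1) + 1) _ :=
      Run.loop_of_invariant (fun y =>
        { mat := segment e (x * n + y) (n * n), mat' := reversed e (x * n + y)
          row := r, row' := r', alive := segment L 0 n
          msk := segment m (x + 1) n, msk' := reversed m x
          dup := segment m y n, dup' := reversed m y
          flag := bit ((b || anyBelow (fun x => anyBelow
            (fun y => m x && m y && !(e (x * n + y)).getD true) n) x) || anyBelow
            (fun y => m x && m y && !(e (x * n + y)).getD true) y)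
          sweep := sw, vert := ve, vert' := ve', color := co }) n
        (fun y hy => ⟨m y, _, segment_of_lt m hy,
          (run_checkEntry (segment_of_lt e (mul_add_lt hx hy)) rfl).of_eq
            (by simp [reversed, anyBelow, Bool.or_assoc]; rfl) le_rfl⟩) (segment_self m n)
    refine (h.seq ((run_move (k := .dup') (k' := .dup) (by decide) id _).seq (Run.push _ _))).congr
      ?_ ?_ ?_
    · simp [reversed, anyBelow]
    · simp [reverse_reversed, segment_self, anyBelow, Nat.succ_mul, reversed, Bool.or_assoc]
    · simp [length_reversed]
      omega

theorem run_applyMask (M r r' : List (Option Bool)) (m : ℕ → Bool) (b : Bool) (d : List Bool) :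
    Run applyMask
      { mat := M, row := r, row' := r', alive := segment L 0 n
        msk := segment m 0 n, dup := d, flag := bit b
        sweep := sw, vert := ve, vert' := ve', color := co }
      (5 * n + 5)
      { mat := M, row := r, row' := r'
        alive := segment (if b then L else fun j => L j && !m j) 0 n, dup := d
        sweep := sw, vert := ve, vert' := ve', color := if b then co else co.tail } := by
  cases b
  · have h : Run (loop .alive removeEntry) _ (n * (2 + 1) + 1) _ :=
      Run.loop_of_invariant (fun j =>
        { mat := M, row := r, row' := r', alive := segment L j n
          alive' := reversed (fun j => L j && !m j) j
          msk := segment m j n, dup := d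
          sweep := sw, vert := ve, vert' := ve', color := co.tail }) n
        (fun j hj => ⟨L j, _, segment_of_lt L hj, run_removeEntry (segment_of_lt m hj)⟩)
        (segment_self L n)
    refine (Run.pop (Run.seq (Run.pop Run.skip) (Run.seq h
      (run_move (k := .alive') (k' := .alive) (by decide) id _)))).of_eq ?_ ?_
    · simp [reverse_reversed, segment_self]
    · simp [length_reversed]
      omega
  · refine (Run.pop (run_clear _ _)).of_eq ?_ ?_
    · simp [bit]
    · simp [length_segment]
      omega

theorem run_visit (hv : v < n) (q : ℕ) :
    Run visit
      { mat := segment e 0 (n * n), row := segment e (v * n) (n * n), row' := reversed e (v * n)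
        alive := segment L 0 n, sweep := sw, vert := ve, vert' := ve'
        color := List.replicate q () }
      (n * (9 * n + 3 + 1) + 2 * (n * n) + 24 * n + 14)
      { mat := segment e 0 (n * n), row := segment e ((v + 1) * n) (n * n)
        row' := reversed e ((v + 1) * n), alive := segment (visitStep n e (L, q) v).1 0 n
        sweep := sw, vert := ve, vert' := () :: ve'
        color := List.replicate (visitStep n e (L, q) v).2 () } := by
  refine ((run_scanRow _ _ _ _ hv).seq ((run_scanMatrix _ _ _ _ _ _ _ _).seq
    ((run_applyMask _ _ _ _ _ _ _ _ _ _).seq ((run_clear .dup _).seq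
      (Run.push _ _))))).of_eq ?_ ?_
  · simp only [visitStep, isBad]
    split <;> simp [*]
  · simp [length_segment]
    omega

end Visit

/-! ### Sweeps over all vertices -/

section Sweep

/-- Process all vertices in turn. -/
def sweepAll : StackProg Sym :=
  seq (loop .vert fun _ => visit) (seq (move .vert' .vert id) (move .row' .row id))

variable (n : ℕ) (e : ℕ → Option Bool)

/-- The effect of the first `v` visits of a sweep on the alive vertices and the number of colors. -/
def visitSteps (p : (ℕ → Bool) × ℕ) : ℕ → (ℕ → Bool) × ℕ
  | 0 => p
  | v + 1 => visitStep n e (visitSteps p v) v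

/-- The number of steps of a visit. -/
def visitTime (n : ℕ) : ℕ := n * (9 * n + 3 + 1) + 2 * (n * n) + 24 * n + 14

/-- The number of steps of a sweep. -/
def sweepTime (n : ℕ) : ℕ := n * (visitTime n + 1) + 2 * n + 2 * (n * n) + 3

variable {n e}

theorem run_sweepAll (sw : List Unit) (p : (ℕ → Bool) × ℕ) :
    Run sweepAll
      { mat := segment e 0 (n * n), row := segment e 0 (n * n), alive := segment p.1 0 n
        sweep := sw, vert := List.replicate n (), color := List.replicate p.2 () }
      (sweepTime n)
      { mat := segment e 0 (n * n), row := segment e 0 (n * n)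
        alive := segment (visitSteps n e p n).1 0 n
        sweep := sw, vert := List.replicate n ()
        color := List.replicate (visitSteps n e p n).2 () } := by
  have h : Run (loop .vert fun _ => visit) _ (n * (visitTime n + 1) + 1) _ :=
    Run.loop_of_invariant (fun v =>
      { mat := segment e 0 (n * n), row := segment e (v * n) (n * n), row' := reversed e (v * n)
        alive := segment (visitSteps n e p v).1 0 n, sweep := sw
        vert := List.replicate (n - v) (), vert' := List.replicate v ()
        color := List.replicate (visitSteps n e p v).2 () }) n
      (fun v hv => ⟨(), _, replicate_sub_of_lt hv, run_visit _ _ _ hv _⟩) (by simp)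
  refine (h.seq ((run_move (k := .vert') (k' := .vert) (by decide) id _).seq
    (run_move (k := .row') (k' := .row) (by decide) id _))).congr ?_ ?_ ?_
  · simp [reversed, visitSteps]
  · simp [reverse_reversed, segment_self]
  · simp [length_reversed, sweepTime]
    omega

theorem run_sweeps (p : (ℕ → Bool) × ℕ) :
    Run (loop .sweep fun _ => sweepAll)
      { mat := segment e 0 (n * n), row := segment e 0 (n * n), alive := segment p.1 0 n
        sweep := List.replicate n (), vert := List.replicate n ()
        color := List.replicate p.2 () }
      (n * (sweepTime n + 1) + 1)
      { mat := segment e 0 (n * n), row := segment e 0 (n * n)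
        alive := segment ((fun p => visitSteps n e p n)^[n] p).1 0 n
        vert := List.replicate n ()
        color := List.replicate ((fun p => visitSteps n e p n)^[n] p).2 () } := by
  refine (Run.loop_of_invariant (k := .sweep) (fun i =>
      { mat := segment e 0 (n * n), row := segment e 0 (n * n)
        alive := segment ((fun p => visitSteps n e p n)^[i] p).1 0 n
        sweep := List.replicate (n - i) (), vert := List.replicate n ()
        color := List.replicate ((fun p => visitSteps n e p n)^[i] p).2 () }) n
      (fun i hi => ⟨(), _, replicate_sub_of_lt hi, (run_sweepAll _ _).of_eq ?_ le_rfl⟩)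
      (by simp)).congr ?_ ?_ le_rfl
  · simp [Function.iterate_succ_apply']
  · simp
  · simp

end Sweep

/-! ### Preprocessing of the input -/

section Split

/-- Copy a row of the input to both matrices, with a mark on the diagonal. -/
def splitRow : StackProg Sym :=
  seq (loop .vert' fun _ => copyEntry) (seq (move .flag .vert' id)
    (seq (pop .inp fun _ => seq (push .mat' none) (push .row' none))
      (seq (loop .vert fun _ => copyEntry) (seq (move .flag .vert id)
        (seq (pop .inp fun _ => skip) (push .vert' ()))))))

/-- Turn the input into two flat matrices, and count the vertices. -/
def preprocess : StackProg Sym :=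
  seq (loop .inp countEntry) (seq (move .mat .inp id) (seq (loop .vert fun _ => splitRow)
    (seq (move .vert' .vert id) (seq (move .mat' .mat id) (move .row' .row id)))))

variable {n : ℕ} {e w : ℕ → Option Bool}

theorem mul_succ_add_lt {x j : ℕ} (hx : x < n) (hj : j ≤ n) :
    x * (n + 1) + j < n * (n + 1) := by
  calc x * (n + 1) + j < x * (n + 1) + (n + 1) := by omega
    _ = (x + 1) * (n + 1) := by ring
    _ ≤ n * (n + 1) := Nat.mul_le_mul_right _ hx

/-- The counters `vert'` and `vert` stand at `i` and `n - (i + 1)`, the numbers of entries before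
and after the diagonal of row `i`; looping on them locates the diagonal. The flag stack collects the
consumed symbols in order to restore each counter. The last pop drops the end-of-row mark. -/
theorem run_splitRow (hw : ∀ i < n, ∀ j < n, i ≠ j → w (i * (n + 1) + j) = e (i * n + j))
    (he : ∀ i < n, e (i * n + i) = none) (sw co : List Unit) (al : List Bool) {i : ℕ} (hi : i < n) :
    Run splitRow
      { inp := segment w (i * (n + 1)) (n * (n + 1))
        mat' := reversed e (i * n), row' := reversed e (i * n), alive := al, sweep := sw
        vert := List.replicate (n - (i + 1)) (), vert' := List.replicate i (), color := co }
      (7 * n + 10)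
      { inp := segment w ((i + 1) * (n + 1)) (n * (n + 1))
        mat' := reversed e ((i + 1) * n), row' := reversed e ((i + 1) * n), alive := al, sweep := sw
        vert := List.replicate (n - (i + 1)) (), vert' := List.replicate (i + 1) ()
        color := co } := by
  have h₁ : Run (loop .vert' fun _ => copyEntry) _ (i * (4 + 1) + 1) _ :=
    Run.loop_of_invariant (fun j =>
      { inp := segment w (i * (n + 1) + j) (n * (n + 1))
        mat' := reversed e (i * n + j), row' := reversed e (i * n + j), alive := al, sweep := sw
        vert := List.replicate (n - (i + 1)) (), vert' := List.replicate (i - j) ()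
        flag := List.replicate j (), color := co }) i
      (fun j hj => ⟨(), _, replicate_sub_of_lt hj,
        (run_copyEntry (segment_of_lt w (mul_succ_add_lt hi (by omega)))).of_eq
          (by rw [hw i hi j (by omega) (by omega)]; rfl) le_rfl⟩) (by simp)
  have h₂ : Run (loop .vert fun _ => copyEntry) _ ((n - (i + 1)) * (4 + 1) + 1) _ :=
    Run.loop_of_invariant (fun j =>
      { inp := segment w (i * (n + 1) + i + 1 + j) (n * (n + 1))
        mat' := reversed e (i * n + i + 1 + j), row' := reversed e (i * n + i + 1 + j)
        alive := al, sweep := sw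
        vert := List.replicate (n - (i + 1) - j) (), vert' := List.replicate i ()
        flag := List.replicate j (), color := co }) (n - (i + 1))
      (fun j hj => ⟨(), _, replicate_sub_of_lt hj,
        (run_copyEntry (s := {
          inp := segment w (i * (n + 1) + i + 1 + j) (n * (n + 1))
          mat' := reversed e (i * n + i + 1 + j), row' := reversed e (i * n + i + 1 + j)
          alive := al, sweep := sw
          vert := List.replicate (n - (i + 1) - (j + 1)) (), vert' := List.replicate i ()
          flag := List.replicate j (), color := co }) (segment_of_lt w (by
            have := mul_succ_add_lt hi (show i + 1 + j ≤ n by omega)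
            omega))).of_eq
          (by
            have := hw i hi (i + 1 + j) (by omega) (by omega)
            rw [show i * (n + 1) + (i + 1 + j) = i * (n + 1) + i + 1 + j by omega,
              show i * n + (i + 1 + j) = i * n + i + 1 + j by omega] at this
            rw [this]
            rfl) le_rfl⟩) (by simp)
  have h₃ : Run (pop .inp fun _ => seq (push .mat' none) (push .row' none))
      { inp := segment w (i * (n + 1) + i) (n * (n + 1))
        mat' := reversed e (i * n + i), row' := reversed e (i * n + i), alive := al, sweep := sw
        vert := List.replicate (n - (i + 1)) (), vert' := List.replicate i (), color := co } 3
      { inp := segment w (i * (n + 1) + i + 1) (n * (n + 1))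
        mat' := reversed e (i * n + i + 1), row' := reversed e (i * n + i + 1)
        alive := al, sweep := sw
        vert := List.replicate (n - (i + 1)) (), vert' := List.replicate i (), color := co } := by
    refine (Run.pop (Run.seq (Run.push _ _) (Run.push _ _))).of_eq ?_ le_rfl
    simp [reversed, he i hi, segment_of_lt w (mul_succ_add_lt hi hi.le)]
  have h₄ : Run (pop .inp fun _ => skip)
      { inp := segment w (i * (n + 1) + n) (n * (n + 1))
        mat' := reversed e ((i + 1) * n), row' := reversed e ((i + 1) * n), alive := al, sweep := sw
        vert := List.replicate (n - (i + 1)) (), vert' := List.replicate i (), color := co } 2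
      { inp := segment w ((i + 1) * (n + 1)) (n * (n + 1))
        mat' := reversed e ((i + 1) * n), row' := reversed e ((i + 1) * n), alive := al, sweep := sw
        vert := List.replicate (n - (i + 1)) (), vert' := List.replicate i (), color := co } := by
    refine (Run.pop Run.skip).of_eq ?_ le_rfl
    simp [segment_of_lt w (mul_succ_add_lt hi le_rfl), Nat.succ_mul i (n + 1), add_assoc]
  have hn : n - (i + 1) + (i + 1) = n := by omega
  refine (h₁.seq (((run_move (k := .flag) (k' := .vert') (by decide) id _).of_eq ?_ le_rfl).seq
    (h₃.seq ((h₂.congr ?_ rfl le_rfl).seq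
    (((run_move (k := .flag) (k' := .vert) (by decide) id _).of_eq ?_ le_rfl).seq
    (h₄.seq (Run.push _ _))))))).congr ?_ ?_ ?_
  · simp
  · simp
  · have h₅ : i * (n + 1) + i + 1 + (n - (i + 1)) = i * (n + 1) + n := by omega
    have h₆ : i * n + i + 1 + (n - (i + 1)) = (i + 1) * n := by rw [Nat.succ_mul]; omega
    simp [h₅, h₆]
  · simp
  · simp [List.replicate_succ]
  · simp
    omega

theorem run_preprocess (hw : ∀ i < n, ∀ j < n, i ≠ j → w (i * (n + 1) + j) = e (i * n + j))
    (he : ∀ i < n, e (i * n + i) = none)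
    (hc : (segment w 0 (n * (n + 1))).count none = n) :
    Run (seq (push .color ()) preprocess)
      { inp := segment w 0 (n * (n + 1)) }
      (n * (7 * n + 10 + 1) + 8 * (n * (n + 1)) + 4 * (n * n) + 2 * n + 7)
      { mat := segment e 0 (n * n), row := segment e 0 (n * n)
        alive := segment (fun _ => true) 0 n
        sweep := List.replicate n (), vert := List.replicate n ()
        color := List.replicate (n + 1) () } := by
  have h : Run (loop .vert fun _ => splitRow) _ (n * (7 * n + 10 + 1) + 1) _ :=
    Run.loop_of_invariant (fun i =>
      { inp := segment w (i * (n + 1)) (n * (n + 1))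
        mat' := reversed e (i * n), row' := reversed e (i * n)
        alive := segment (fun _ => true) 0 n, sweep := List.replicate n ()
        vert := List.replicate (n - i) (), vert' := List.replicate i ()
        color := List.replicate (n + 1) () }) n
      (fun i hi => ⟨(), _, replicate_sub_of_lt hi, run_splitRow hw he _ _ _ hi⟩) (by simp)
  refine ((Run.push _ _).seq ((run_loop_countEntry _ _ rfl).seq
    (((run_move (k := .mat) (k' := .inp) (by decide) id _).of_eq ?_ le_rfl).seq
    (h.seq ((run_move (k := .vert') (k' := .vert) (by decide) id _).seq
    ((run_move (k := .mat') (k' := .mat) (by decide) id _).seq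
      (run_move (k := .row') (k' := .row) (by decide) id _))))))).of_eq ?_ ?_
  · simp [hc, reversed, segment_const, List.replicate_succ']
  · simp [reverse_reversed, segment_self]
  · simp [length_reversed, length_segment]
    omega

end Split

/-! ### The complete program -/

section Program

/-- The program that computes the packing chromatic number of a chordal graph of diameter `2`. -/
def packingProgram : StackProg Sym :=
  seq (seq (push .color ()) preprocess) (seq (loop .sweep fun _ => sweepAll)
    (seq (clear .mat) (seq (clear .row) (seq (clear .alive) (seq (clear .vert)
      (loop .color fun _ => increment))))))

/-- The number of steps of the program. -/
def packingTime (n : ℕ) : ℕ :=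
  n * (7 * n + 10 + 1) + 8 * (n * (n + 1)) + 4 * (n * n) + 2 * n + 7 +
    (n * (sweepTime n + 1) + 1 + (4 * (n * n) + 4 * n + 4 + ((n + 1) * (6 * (n + 1) + 10) + 1)))

variable {n : ℕ} {e w : ℕ → Option Bool}

/-- After the sweeps the unary color stack holds the answer `q`; the working stacks are cleared and
`q` is counted in binary. The bound `hqn` makes the time of this last loop a function of `n` alone.
-/
theorem run_packingProgram
    (hw : ∀ i < n, ∀ j < n, i ≠ j → w (i * (n + 1) + j) = e (i * n + j))
    (he : ∀ i < n, e (i * n + i) = none)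
    (hc : (segment w 0 (n * (n + 1))).count none = n) {q : ℕ} (hqn : q ≤ n + 1)
    (hq : ((fun p => visitSteps n e p n)^[n] (fun _ => true, n + 1)).2 = q) :
    Run packingProgram { inp := segment w 0 (n * (n + 1)) } (packingTime n)
      { out := Computability.encodeNat q } := by
  refine ((run_preprocess hw he hc).seq ((run_sweeps (fun _ => true, n + 1)).seq
    ((run_clear .mat _).seq ((run_clear .row _).seq ((run_clear .alive _).seq
    ((run_clear .vert _).seq (run_loop_increment (q := q) ?_ ?_ ?_ ?_))))))).of_eq ?_ ?_
  · simp [hq]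
  · simp
  · simp
  · simp
  · simp
  · have : q * (6 * q + 9 + 1) ≤ (n + 1) * (6 * (n + 1) + 10) :=
      Nat.mul_le_mul hqn (by omega)
    simp [length_segment, packingTime]
    omega

end Program

end StackProg

namespace SimpleGraph

/-! ### The adjacency matrix as a word -/

section Words

variable {n : ℕ} (G : SimpleGraph (Fin n))

open Classical in
/-- Adjacency of two numbers below `n`. -/
noncomputable def adjNat (x y : ℕ) : Bool :=
  decide (∃ (hx : x < n) (hy : y < n), G.Adj ⟨x, hx⟩ ⟨y, hy⟩)

/-- The symbols of the adjacency matrix with end-of-row marks, by position. -/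
noncomputable def markedEntry (p : ℕ) : Option Bool :=
  if p % (n + 1) = n then none else some (G.adjNat (p / (n + 1)) (p % (n + 1)))

/-- The symbols of the adjacency matrix with marks on the diagonal, by position. -/
noncomputable def flatEntry (p : ℕ) : Option Bool :=
  if p / n = p % n then none else some (G.adjNat (p / n) (p % n))

variable {G}

@[simp] theorem adjNat_fin (x y : Fin n) : G.adjNat x y = true ↔ G.Adj x y := by
  simp [adjNat]

theorem markedEntry_of_lt (i : ℕ) {j : ℕ} (hj : j < n) :
    G.markedEntry (i * (n + 1) + j) = some (G.adjNat i j) := by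
  have h₁ : (i * (n + 1) + j) / (n + 1) = i := by
    rw [mul_comm, Nat.mul_add_div (by omega), Nat.div_eq_of_lt (by omega), add_zero]
  have h₂ : (i * (n + 1) + j) % (n + 1) = j := by
    rw [mul_comm, Nat.mul_add_mod, Nat.mod_eq_of_lt (by omega)]
  rw [markedEntry, h₁, h₂, if_neg hj.ne]

theorem markedEntry_last (i : ℕ) : G.markedEntry (i * (n + 1) + n) = none := by
  have h₂ : (i * (n + 1) + n) % (n + 1) = n := by
    rw [mul_comm, Nat.mul_add_mod, Nat.mod_eq_of_lt (by omega)]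
  rw [markedEntry, h₂, if_pos rfl]

theorem flatEntry_of_lt (i : ℕ) {j : ℕ} (hj : j < n) :
    G.flatEntry (i * n + j) = if i = j then none else some (G.adjNat i j) := by
  have h₁ : (i * n + j) / n = i := by
    rw [mul_comm, Nat.mul_add_div (by omega), Nat.div_eq_of_lt (by omega), add_zero]
  have h₂ : (i * n + j) % n = j := by
    rw [mul_comm, Nat.mul_add_mod, Nat.mod_eq_of_lt (by omega)]
  rw [flatEntry, h₁, h₂]

theorem flatMap_range_eq_segment {α : Type} (w : ℕ → α) (r m : ℕ) :
    ((List.range m).flatMap fun i => (List.range r).map fun j => w (i * r + j)) =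
      StackProg.segment w 0 (m * r) := by
  induction m with
  | zero => simp [StackProg.segment]
  | succ m ih =>
    rw [List.range_succ, List.flatMap_append, ih, StackProg.segment, StackProg.segment,
      Nat.sub_zero, Nat.sub_zero, Nat.succ_mul, ← List.range'_append_1, List.map_append]
    simp only [List.flatMap_cons, List.flatMap_nil, List.append_nil, zero_add]
    congr 1
    rw [List.range'_eq_map_range, List.map_map]
    rfl

theorem adjMatrixWord_eq_segment :
    G.adjMatrixWord = StackProg.segment G.markedEntry 0 (n * (n + 1)) := by
  rw [← flatMap_range_eq_segment, ← List.map_coe_finRange_eq_range (n := n), List.flatMap_map,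
    adjMatrixWord]
  congr 1
  funext i
  rw [List.range_succ, List.map_append, List.map_singleton, markedEntry_last,
    ← List.map_coe_finRange_eq_range, List.map_map]
  congr 1
  apply List.map_congr_left
  intro j _
  rw [Function.comp_apply, markedEntry_of_lt _ j.isLt]
  simp [adjNat]

theorem count_none_adjMatrixWord : G.adjMatrixWord.count none = n := by
  classical
  rw [adjMatrixWord, List.count_flatMap, List.map_congr_left (g := fun _ => 1)]
  · simp
  · intro i _
    simp [List.count_eq_zero]

theorem length_adjMatrixWord : G.adjMatrixWord.length = n * (n + 1) := by
  rw [adjMatrixWord_eq_segment, StackProg.length_segment, Nat.sub_zero]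

end Words

/-! ### Correctness of the greedy deletion -/

section Greedy

open StackProg

variable {n : ℕ} {G : SimpleGraph (Fin n)}

/-- The alive vertices. -/
def aliveSet (n : ℕ) (L : ℕ → Bool) : Finset (Fin n) := Finset.univ.filter fun i => L i = true

theorem mem_aliveSet {L : ℕ → Bool} {i : Fin n} : i ∈ aliveSet n L ↔ L i = true := by
  simp [aliveSet]

/-- In row `v` the mark `none` occurs only in column `v`, so the test reads the alive bit of `v`
itself. -/
theorem isDead_flatEntry (L : ℕ → Bool) (v : Fin n) :
    isDead n G.flatEntry L v = true ↔ v ∉ aliveSet n L := by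
  rw [isDead, anyBelow_eq_true, mem_aliveSet]
  constructor
  · rintro ⟨j, hj, h⟩
    rw [flatEntry_of_lt _ hj] at h
    split at h
    · rename_i hvj
      simpa [← hvj] using h
    · simp at h
  · intro h
    refine ⟨v, v.isLt, ?_⟩
    rw [flatEntry_of_lt _ v.isLt]
    simpa using h

theorem mask_flatEntry (L : ℕ → Bool) (v j : Fin n) :
    mask n G.flatEntry L v j = true ↔ j ∈ aliveSet n L ∧ (j = v ∨ G.Adj v j) := by
  rw [mask, mem_aliveSet, flatEntry_of_lt _ j.isLt, Bool.and_eq_true]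
  refine and_congr_right fun _ => ?_
  by_cases h : v = j
  · simp [h]
  · rw [if_neg (fun h' => h (Fin.ext h')), Option.getD_some, adjNat_fin]
    simp [Ne.symm h]

theorem hasNonEdge_flatEntry (m : ℕ → Bool) :
    hasNonEdge n G.flatEntry m = true ↔
      ∃ x y : Fin n, m x = true ∧ m y = true ∧ x ≠ y ∧ ¬ G.Adj x y := by
  have key : ∀ x y : Fin n, (m x && m y && !(G.flatEntry (x * n + y)).getD true) = true ↔
      m x = true ∧ m y = true ∧ x ≠ y ∧ ¬ G.Adj x y := by
    intro x y
    rw [flatEntry_of_lt _ y.isLt]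
    by_cases h : x = y
    · simp [h]
    · rw [if_neg (fun h' => h (Fin.ext h')), ← adjNat_fin (G := G)]
      simp only [Option.getD_some, Bool.and_eq_true, Bool.not_eq_true', Bool.not_eq_true, ne_eq, h,
        not_false_eq_true, true_and, and_assoc]
  simp only [hasNonEdge, anyBelow_eq_true]
  constructor
  · rintro ⟨x, hx, y, hy, h⟩
    exact ⟨⟨x, hx⟩, ⟨y, hy⟩, (key ⟨x, hx⟩ ⟨y, hy⟩).1 h⟩
  · rintro ⟨x, y, h⟩
    exact ⟨x, x.isLt, y, y.isLt, (key x y).2 h⟩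

/-- The mask of an alive `v` is its closed neighborhood among the alive vertices. Since `v` is
adjacent to the rest of it, the mask is a clique exactly when the alive neighbors of `v` form one.
-/
theorem isBad_flatEntry (L : ℕ → Bool) (v : Fin n) :
    isBad n G.flatEntry L v = false ↔
      v ∈ aliveSet n L ∧ G.IsSimplicialIn (aliveSet n L) v := by
  rw [isBad, Bool.or_eq_false_iff, ← Bool.not_eq_true, isDead_flatEntry, not_not,
    ← Bool.not_eq_true, hasNonEdge_flatEntry]
  refine and_congr_right fun hv => ?_
  simp only [mask_flatEntry]
  constructor
  · intro h x hx y hy hvx hvy hxy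
    by_contra hadj
    exact h ⟨x, y, ⟨hx, .inr hvx⟩, ⟨hy, .inr hvy⟩, hxy, hadj⟩
  · rintro h ⟨x, y, ⟨hx, hvx⟩, ⟨hy, hvy⟩, hxy, hadj⟩
    rcases hvx with rfl | hvx
    · rcases hvy with rfl | hvy
      · exact hxy rfl
      · exact hadj hvy
    · rcases hvy with rfl | hvy
      · exact hadj hvx.symm
      · exact hadj (h x hx y hy hvx hvy hxy)

/-- The number of colors that are not spent is determined by the alive vertices. -/
def ColorInvariant (G : SimpleGraph (Fin n)) (p : (ℕ → Bool) × ℕ) : Prop :=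
  p.2 + G.indepNum = n + 1 + G.indepNumIn (aliveSet n p.1)

theorem indepNum_le : G.indepNum ≤ n := by
  obtain ⟨I, hI⟩ := G.exists_isNIndepSet_indepNum
  simpa [hI.card_eq] using Finset.card_le_univ I

theorem aliveSet_visitStep [DecidableRel G.Adj] {p : (ℕ → Bool) × ℕ} {v : Fin n}
    (h : isBad n G.flatEntry p.1 v = false) :
    aliveSet n (visitStep n G.flatEntry p v).1 =
      (aliveSet n p.1).filter fun x => ¬ (x = v ∨ G.Adj v x) := by
  ext x
  have hm := mask_flatEntry (G := G) p.1 v x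
  rw [mem_aliveSet] at hm
  rw [visitStep, h, Finset.mem_filter, mem_aliveSet, mem_aliveSet]
  simp only [Bool.false_eq_true, if_false, Bool.and_eq_true, Bool.not_eq_true', ← Bool.not_eq_true,
    hm]
  tauto

theorem ColorInvariant.visitStep {p : (ℕ → Bool) × ℕ} (hp : G.ColorInvariant p) (v : Fin n) :
    G.ColorInvariant (visitStep n G.flatEntry p v) := by
  classical
  cases h : isBad n G.flatEntry p.1 v
  · obtain ⟨hv, hs⟩ := (isBad_flatEntry p.1 v).1 h
    have h₁ := hs.indepNumIn_filter hv
    have h₂ : (StackProg.visitStep n G.flatEntry p v).2 = p.2 - 1 := by simp [StackProg.visitStep, h]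
    -- With α ≤ n the invariant forces `p.2` to be positive, so the truncated `p.2 - 1` is a genuine
    -- decrement.
    have := indepNum_le (G := G)
    rw [ColorInvariant] at hp ⊢
    rw [aliveSet_visitStep h, h₂]
    omega
  · rwa [StackProg.visitStep, if_pos h]

theorem card_aliveSet_visitStep (p : (ℕ → Bool) × ℕ) (v : Fin n) :
    (StackProg.visitStep n G.flatEntry p v = p ∧ isBad n G.flatEntry p.1 v = true) ∨
      (aliveSet n (StackProg.visitStep n G.flatEntry p v).1).card < (aliveSet n p.1).card := by
  classical
  cases h : isBad n G.flatEntry p.1 v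
  · right
    rw [aliveSet_visitStep h]
    apply Finset.card_lt_card
    rw [Finset.filter_ssubset]
    exact ⟨v, ((isBad_flatEntry p.1 v).1 h).1, by simp⟩
  · exact .inl ⟨if_pos h, rfl⟩

theorem ColorInvariant.visitSteps {p : (ℕ → Bool) × ℕ} (hp : G.ColorInvariant p) {k : ℕ}
    (hk : k ≤ n) : G.ColorInvariant (visitSteps n G.flatEntry p k) := by
  induction k with
  | zero => exact hp
  | succ k ih => exact (ih (by omega)).visitStep ⟨k, hk⟩

/-- Without a deletion the alive set never changes during the sweep, so all verdicts refer to the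
same initial set `p`; this is what contradicts Dirac's theorem when that set is nonempty. -/
theorem card_aliveSet_visitSteps (p : (ℕ → Bool) × ℕ) {k : ℕ} (hk : k ≤ n) :
    (visitSteps n G.flatEntry p k = p ∧ ∀ v < k, isBad n G.flatEntry p.1 v = true) ∨
      (aliveSet n (visitSteps n G.flatEntry p k).1).card < (aliveSet n p.1).card := by
  induction k with
  | zero => exact .inl ⟨rfl, by simp⟩
  | succ k ih =>
    have hstep := card_aliveSet_visitStep (G := G) (StackProg.visitSteps n G.flatEntry p k) ⟨k, hk⟩
    simp only at hstep
    rw [StackProg.visitSteps]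
    rcases ih (by omega) with ⟨h₁, h₂⟩ | h
    · rw [h₁] at hstep ⊢
      rcases hstep with ⟨h₃, h₄⟩ | h₃
      · refine .inl ⟨h₃, fun v hv => ?_⟩
        rcases Nat.lt_succ_iff_lt_or_eq.1 hv with hv | rfl
        · exact h₂ v hv
        · exact h₄
      · exact .inr h₃
    · rcases hstep with ⟨h₃, -⟩ | h₃
      · rw [h₃]
        exact .inr h
      · exact .inr (h₃.trans h)

/-- In a chordal graph the sweeps spend as many colors as the independence number. -/
theorem IsChordal.visitSteps_iterate (hG : G.IsChordal) :
    ((fun p => visitSteps n G.flatEntry p n)^[n] (fun _ => true, n + 1)).2 + G.indepNum =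
      n + 1 := by
  have key : ∀ i, G.ColorInvariant
        ((fun p => visitSteps n G.flatEntry p n)^[i] (fun _ => true, n + 1)) ∧
      (aliveSet n ((fun p => visitSteps n G.flatEntry p n)^[i] (fun _ => true, n + 1)).1).card
        ≤ n - i := by
    intro i
    induction i with
    | zero =>
      have h : aliveSet n (fun _ => true) = Finset.univ := by simp [aliveSet]
      refine ⟨?_, ?_⟩
      · rw [ColorInvariant, Function.iterate_zero, id, h, indepNumIn_univ]
      · simpa using Finset.card_le_univ (aliveSet n fun _ => true)
    | succ i ih =>
      rw [Function.iterate_succ_apply']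
      generalize (fun p => visitSteps n G.flatEntry p n)^[i] (fun _ => true, n + 1) = p at ih ⊢
      refine ⟨ih.1.visitSteps le_rfl, ?_⟩
      rcases card_aliveSet_visitSteps (G := G) p le_rfl with ⟨h₁, h₂⟩ | h
      -- A sweep without deletion found no simplicial vertex in the alive set, which is therefore
      -- empty.
      · have hempty : aliveSet n p.1 = ∅ := by
          by_contra hne
          obtain ⟨z, hz, hs⟩ := hG.exists_isSimplicialIn (Finset.nonempty_iff_ne_empty.2 hne)
          have := (isBad_flatEntry (G := G) p.1 z).2 ⟨hz, hs⟩
          rw [h₂ z z.isLt] at this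
          exact absurd this (by simp)
        simp [h₁, hempty]
      · have := ih.2
        omega
  obtain ⟨h₁, h₂⟩ := key n
  rw [Nat.sub_self, Nat.le_zero, Finset.card_eq_zero] at h₂
  rw [ColorInvariant, h₂, indepNumIn_empty] at h₁
  exact h₁

end Greedy

/-! ### Assembly of the polynomial-time machine -/

theorem polyTimeComputable_packingChromaticNumber :
    PolyTimeComputable
      (fun g : ChordalDiamTwo => g.1.2.adjMatrixWord)
      Computability.encodeNat
      (fun g : ChordalDiamTwo => g.1.2.packingChromaticNumber) := by
  obtain ⟨P, hP⟩ : ∃ P : Polynomial ℕ, ∀ m, P.eval m = StackProg.packingTime m := by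
    let X : Polynomial ℕ := Polynomial.X
    let vt := X * (9 * X + 3 + 1) + 2 * (X * X) + 24 * X + 14
    let st := X * (vt + 1) + 2 * X + 2 * (X * X) + 3
    refine ⟨X * (7 * X + 10 + 1) + 8 * (X * (X + 1)) + 4 * (X * X) + 2 * X + 7 +
      (X * (st + 1) + 1 + (4 * (X * X) + 4 * X + 4 + ((X + 1) * (6 * (X + 1) + 10) + 1))),
      fun m => ?_⟩
    simp [X, vt, st, StackProg.packingTime, StackProg.sweepTime, StackProg.visitTime]
  -- The time is a polynomial in `n`, while the bound is to be in the input length `n * (n + 1)`,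
  -- which is at least `n`; monotonicity bridges the two.
  have hmono : Monotone StackProg.packingTime := by
    intro a b h
    simp only [StackProg.packingTime, StackProg.sweepTime, StackProg.visitTime]
    gcongr
  refine StackProg.polyTimeComputable (Γ := StackProg.Sym) StackProg.packingProgram .inp .out
    _ _ _ P ?_
  rintro ⟨⟨n, G⟩, hG, hd⟩
  have hχ : G.packingChromaticNumber + G.indepNum = n + 1 := by
    simpa using packingChromaticNumber_add_indepNum (G := G) hd
  have hq : ((fun p => StackProg.visitSteps n G.flatEntry p n)^[n] (fun _ => true, n + 1)).2 =
      G.packingChromaticNumber := by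
    have := IsChordal.visitSteps_iterate (G := G) hG
    omega
  have hrun := StackProg.run_packingProgram (n := n) (e := G.flatEntry) (w := G.markedEntry)
    (fun i hi j hj hij => by rw [markedEntry_of_lt i hj, flatEntry_of_lt i hj, if_neg hij])
    (fun i hi => by rw [flatEntry_of_lt i hi, if_pos rfl])
    (by rw [← adjMatrixWord_eq_segment, count_none_adjMatrixWord])
    (q := G.packingChromaticNumber) (by omega) hq
  rw [← adjMatrixWord_eq_segment] at hrun
  have hin : (StackProg.Stacks.get { inp := G.adjMatrixWord }) =
      Function.update (β := fun k => List (StackProg.Sym k)) (fun _ => []) .inp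
        G.adjMatrixWord := by
    funext k; cases k <;> rfl
  have hout : (StackProg.Stacks.get { out := Computability.encodeNat G.packingChromaticNumber }) =
      Function.update (β := fun k => List (StackProg.Sym k)) (fun _ => []) .out
        (Computability.encodeNat G.packingChromaticNumber) := by
    funext k; cases k <;> rfl
  rw [StackProg.Run, hin, hout] at hrun
  refine hrun.mono ?_
  rw [hP]
  apply hmono
  simp only [length_adjMatrixWord]
  exact Nat.le_mul_of_pos_right n (by omega)

end SimpleGraph

theorem proposition1 :
    -- the packing chromatic number of chordal graphs of diameter 2 is computable in polynomial time
    PolyTimeComputable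
      (fun g : ChordalDiamTwo => g.1.2.adjMatrixWord)
      Computability.encodeNat
      (fun g : ChordalDiamTwo => g.1.2.packingChromaticNumber) ∧
    -- in graphs of diameter 2 only color 1 can repeat, and the number is given by the
    -- largest independent sets
    ∀ {V : Type*} [Fintype V] (G : SimpleGraph V), G.ediam = 2 →
      (∀ (k : ℕ) (φ : V → ℕ), G.IsPackingColoring k φ →
        ∀ u v, u ≠ v → φ u = φ v → φ u = 1) ∧
      G.packingChromaticNumber + G.indepNum = Fintype.card V + 1 :=
  ⟨SimpleGraph.polyTimeComputable_packingChromaticNumber, fun _ hd =>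
    ⟨fun _ _ h _ _ huv he => h.eq_one_of_ediam_eq_two hd huv he,
      SimpleGraph.packingChromaticNumber_add_indepNum hd⟩⟩
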